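/- Let $\mathbb K$ be a field of characteristic $0$, let $A=\bigoplus_{e\in\mathbb Z}A^e$ be a graded $\mathbb K$-vector space, and let $\mathcal C(A)=\bigoplus_{w\ge 0}(sA)^{\otimes (w+1)}$ be the cofree (reduced tensor) coassociative coalgebra on the suspension $sA$ (an element of $A$ of degree $e$ has degree $e-1$ in $sA$), with the deconcatenation coproduct. The summand $(sA)^{\otimes(w+1)}$ has weight $w$, and a coderivation has weight $i$ if it lowers this weight by $i$. Let $\mathrm{Coder}(\mathcal C(A))$ be the graded Lie algebra of coderivations and $F^p\mathrm{Coder}(\mathcal C(A))$ the subspace of coderivations all of whose components of weight less than $p$ vanish. The same notions are used over any commutative ring in place of $\mathbb K$. Let $Q=q_1+q_2+\cdots$ be a minimal $A_\infty$-algebra structure on $A$, that is, a coderivation of $\mathcal C(A)$ of degree $1$ with $Q^2=0$ and without component of weight $0$, where $q_i$ is its component of weight $i$. For $m\ge 0$ the truncated operadic Kaledin class is $$K_A^{\le m}=[q_2+2q_3+\cdots+(m-1)q_m]\in H^1\bigl(F^1\mathrm{Coder}(\mathcal C(A))/F^{m+1}\mathrm{Coder}(\mathcal C(A)),\,[Q,-]\bigr).$$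 For $n\ge 0$ consider the $\mathbb K[h]/h^{n+1}$-linear minimal $A_\infty$-algebra $A[h]/h^{n+1}$ with structure $Q'=q_1+hq_2+\cdots+h^nq_{n+1}$, and let $\delta_h$ be the formal derivative with respect to $h$. Then $\delta_hQ'=q_2+2hq_3+\cdots+nh^{n-1}q_{n+1}$ is a cocycle of degree $1$ in the $\mathbb K[h]/h^n$-linear Hochschild complex $(\mathrm{Coder},[Q',-])$ of $A[h]/h^n$ (whose structure is $Q'$ modulo $h^n$). Its class $[\delta_hQ']$, the Kaledin–Lunts class of $A[h]/h^{n+1}$, vanishes in the Hochschild cohomology of $A[h]/h^n$ if and only if $K_A^{\le n+1}=0$. -/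

import Mathlib

open scoped TensorProduct DirectSum Polynomial

set_option linter.unusedSectionVars false

noncomputable section

namespace AInfinity

section Coalgebra

variable (R A : Type*) [CommRing R] [AddCommGroup A] [Module R A]

/-- The underlying module of the cofree (conilpotent, non-counital) coassociative coalgebra on the
suspension `sA`: the reduced tensor module `⨁_{w ≥ 0} (sA)^{⊗ (w + 1)}`. The direct sum index `w`
is the weight: for the operad `Ass`, the Koszul dual cooperad in weight `w` has arity `w + 1`. The
suspension only affects the cohomological degrees, see `degPart` below. -/
def Bar : Type _ := ⨁ w : ℕ, ⨂[R]^(w + 1) A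

instance : AddCommGroup (Bar R A) := inferInstanceAs (AddCommGroup (⨁ w : ℕ, ⨂[R]^(w + 1) A))

instance {T : Type*} [CommRing T] [Algebra T R] : Module T (Bar R A) :=
  inferInstanceAs (Module T (⨁ w : ℕ, ⨂[R]^(w + 1) A))

instance {T : Type*} [CommRing T] [Algebra T R] : IsScalarTower T R (Bar R A) :=
  inferInstanceAs (IsScalarTower T R (⨁ w : ℕ, ⨂[R]^(w + 1) A))

/-- Inclusion of the weight `w` part. -/
def inc (w : ℕ) : ⨂[R]^(w + 1) A →ₗ[R] Bar R A :=
  DirectSum.lof R ℕ (fun w => ⨂[R]^(w + 1) A) w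

/-- Projection to the weight `w` part. -/
def pr (w : ℕ) : Bar R A →ₗ[R] ⨂[R]^(w + 1) A :=
  DirectSum.component R ℕ (fun w => ⨂[R]^(w + 1) A) w

variable {R A} in
/-- The linear map on `Bar R A` with given restrictions to the weight components. -/
def desc {M : Type*} [AddCommGroup M] [Module R M] (f : ∀ w : ℕ, ⨂[R]^(w + 1) A →ₗ[R] M) :
    Bar R A →ₗ[R] M :=
  DirectSum.toModule R ℕ M f

variable {R A}

theorem desc_inc {M : Type*} [AddCommGroup M] [Module R M] (f : ∀ w : ℕ, ⨂[R]^(w + 1) A →ₗ[R] M)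
    (w : ℕ) (x : ⨂[R]^(w + 1) A) : desc f (inc R A w x) = f w x :=
  DirectSum.toModule_lof (R := R) (ι := ℕ) (M := fun w => ⨂[R]^(w + 1) A) (φ := f) w x

theorem pr_inc_self (w : ℕ) (x : ⨂[R]^(w + 1) A) : pr R A w (inc R A w x) = x :=
  DirectSum.component.lof_self R (ι := ℕ) (M := fun w => ⨂[R]^(w + 1) A) w x

theorem pr_inc_ne {w k : ℕ} (h : w ≠ k) (x : ⨂[R]^(w + 1) A) : pr R A k (inc R A w x) = 0 :=
  (DirectSum.component.of R (ι := ℕ) (M := fun w => ⨂[R]^(w + 1) A) k w x).trans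
    (dif_neg h)

theorem bar_hom_ext {M : Type*} [AddCommGroup M] [Module R M] {f g : Bar R A →ₗ[R] M}
    (h : ∀ w, f ∘ₗ inc R A w = g ∘ₗ inc R A w) : f = g :=
  DirectSum.linearMap_ext R h

@[elab_as_elim]
theorem bar_induction {P : Bar R A → Prop} (x : Bar R A) (zero : P 0)
    (inc : ∀ w y, P (inc R A w y)) (add : ∀ x y, P x → P y → P (x + y)) : P x :=
  DirectSum.induction_on x zero inc add

/-- The word `a₀ ⊗ ⋯ ⊗ a_w`, an element of weight `w`. -/
def word {w : ℕ} (a : Fin (w + 1) → A) : Bar R A :=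
  inc R A w (PiTensorProduct.tprod R a)

variable (R A)

/-- The weight `w` projector. -/
def proj (w : ℕ) : Module.End R (Bar R A) := inc R A w ∘ₗ pr R A w

/-- Splitting a tensor of length `w + 1` after its first `i + 1` letters, for `i < w`. -/
def split (w : ℕ) (i : Fin w) :
    ⨂[R]^(w + 1) A →ₗ[R] (⨂[R]^(i.1 + 1) A) ⊗[R] (⨂[R]^(w - 1 - i.1 + 1) A) :=
  (TensorPower.mulEquiv (R := R) (M := A) (n := i.1 + 1) (m := w - 1 - i.1 + 1)).symm.toLinearMap ∘ₗ
    (TensorPower.cast R A (by omega : w + 1 = (i.1 + 1) + (w - 1 - i.1 + 1))).toLinearMap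

/-- The reduced deconcatenation coproduct
`Δ (a₀ ⊗ ⋯ ⊗ a_w) = ∑_{0 ≤ i < w} (a₀ ⊗ ⋯ ⊗ a_i) ⊗ (a_{i+1} ⊗ ⋯ ⊗ a_w)`. -/
def comul : Bar R A →ₗ[R] Bar R A ⊗[R] Bar R A :=
  desc fun w => ∑ i : Fin w,
    TensorProduct.map (inc R A i.1) (inc R A (w - 1 - i.1)) ∘ₗ split R A w i

variable {R A}

theorem split_tprod (w : ℕ) (i : Fin w) (a : Fin (w + 1) → A) :
    split R A w i (PiTensorProduct.tprod R a) =
      PiTensorProduct.tprod R (fun k : Fin (i.1 + 1) => a ⟨k.1, by omega⟩) ⊗ₜ[R]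
      PiTensorProduct.tprod R (fun k : Fin (w - 1 - i.1 + 1) => a ⟨i.1 + 1 + k.1, by omega⟩) := by
  unfold split
  simp only [LinearMap.comp_apply, LinearEquiv.coe_coe]
  rw [LinearEquiv.symm_apply_eq, TensorPower.cast_tprod, ← TensorPower.gMul_def,
    TensorPower.tprod_mul_tprod]
  congr 1
  funext k
  refine Fin.addCases (fun k => ?_) (fun k => ?_) k
  · rw [Fin.append_left]; rfl
  · rw [Fin.append_right]; rfl

theorem comul_word {w : ℕ} (a : Fin (w + 1) → A) :
    comul R A (word a) = ∑ i : Fin w,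
      word (R := R) (fun k : Fin (i.1 + 1) => a ⟨k.1, by omega⟩) ⊗ₜ[R]
      word (R := R) (fun k : Fin (w - 1 - i.1 + 1) => a ⟨i.1 + 1 + k.1, by omega⟩) := by
  simp only [comul, word, desc_inc, LinearMap.sum_apply, LinearMap.comp_apply,
    split_tprod, TensorProduct.map_tmul]

theorem hom_ext_word {M : Type*} [AddCommGroup M] [Module R M] {f g : Bar R A →ₗ[R] M}
    (h : ∀ (w : ℕ) (a : Fin (w + 1) → A), f (word a) = g (word a)) : f = g := by
  refine bar_hom_ext fun w => ?_
  refine PiTensorProduct.ext ?_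
  ext a
  exact h w a

theorem proj_word {w : ℕ} (k : ℕ) (a : Fin (w + 1) → A) :
    proj R A k (word a) = if w = k then word a else 0 := by
  simp only [proj, word, LinearMap.comp_apply]
  split_ifs with h
  · subst h; rw [pr_inc_self]
  · rw [pr_inc_ne h, map_zero]

end Coalgebra

section Grading

variable {R A : Type*} [CommRing R] [AddCommGroup A] [Module R A]
variable (𝒜 : ℤ → Submodule R A) [DirectSum.Decomposition 𝒜]

/-- The submodule of `Bar R A` of elements of cohomological degree `p`. It is spanned by the words
`a₀ ⊗ ⋯ ⊗ a_w` in homogeneous letters such that `∑ (|a_k| - 1) = p`, since a letter of degree `e`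
in `A` has degree `e - 1` in the suspension `sA`. -/
def degPart (p : ℤ) : Submodule R (Bar R A) :=
  Submodule.span R {x | ∃ (w : ℕ) (a : Fin (w + 1) → A) (e : Fin (w + 1) → ℤ),
    (∀ k, a k ∈ 𝒜 (e k)) ∧ ∑ k, (e k - 1) = p ∧ x = word a}

/-- The Koszul sign operator on letters: `a ↦ (-1)^{d (|a| - 1)} a` on homogeneous elements. -/
def letterSign (d : ℤ) : A →ₗ[R] A :=
  (DirectSum.toModule R ℤ A fun e => ((d * (e - 1)).negOnePow : ℤ) • (𝒜 e).subtype) ∘ₗ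
    (DirectSum.decomposeLinearEquiv 𝒜).toLinearMap

/-- The Koszul sign operator on `Bar R A`: `x ↦ (-1)^{d |x|} x` on homogeneous elements. -/
def koszulSign (d : ℤ) : Module.End R (Bar R A) :=
  desc fun w => inc R A w ∘ₗ PiTensorProduct.map fun _ : Fin (w + 1) => letterSign 𝒜 d

/-- Coderivations of cohomological degree `d`: the linear endomorphisms `D` of degree `d` with
`Δ D = (D ⊗ id + id ⊗ D) Δ`, where `(id ⊗ D) (x ⊗ y) = (-1)^{d |x|} x ⊗ D y`. -/
def Coder (d : ℤ) : Submodule R (Module.End R (Bar R A)) where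
  carrier := {D | (∀ p, ∀ x ∈ degPart 𝒜 p, D x ∈ degPart 𝒜 (p + d)) ∧
    comul R A ∘ₗ D =
      (TensorProduct.map D LinearMap.id + TensorProduct.map (koszulSign 𝒜 d) D) ∘ₗ comul R A}
  zero_mem' := by
    refine ⟨fun p x _ => by simp, ?_⟩
    simp
  add_mem' := by
    rintro D E ⟨hD, hD'⟩ ⟨hE, hE'⟩
    refine ⟨fun p x hx => by simpa using add_mem (hD p x hx) (hE p x hx), ?_⟩
    rw [LinearMap.comp_add, hD', hE', TensorProduct.map_add_left, TensorProduct.map_add_right]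
    simp only [LinearMap.add_comp]
    abel
  smul_mem' := by
    rintro r D ⟨hD, hD'⟩
    refine ⟨fun p x hx => by simpa using Submodule.smul_mem _ r (hD p x hx), ?_⟩
    rw [LinearMap.comp_smul, hD', TensorProduct.map_smul_left, TensorProduct.map_smul_right,
      ← smul_add, LinearMap.smul_comp]

variable (R A) in
/-- The weight filtration: `D ∈ F^p` if all components of `D` of weight less than `p` vanish, where
the components of weight `i` are those that lower the weight in `Bar R A` by `i`. For the coderivation
with corestrictions `f_i : (sA)^{⊗ (i + 1)} → sA` the weight `i` component is the coderivation extending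
`f_i`, so on coderivations this is the filtration by the condition `f_i = 0` for `i < p`. -/
def weightFil (p : ℕ) : Submodule R (Module.End R (Bar R A)) where
  carrier := {D | ∀ k l : ℕ, k < l + p → proj R A l * D * proj R A k = 0}
  zero_mem' := by intro k l _; simp
  add_mem' := by
    intro D E hD hE k l h
    rw [mul_add, add_mul, hD k l h, hE k l h, add_zero]
  smul_mem' := by
    intro r D hD k l h
    rw [mul_smul_comm, smul_mul_assoc, hD k l h, smul_zero]

/-- The weight `i` component of an endomorphism: the part that maps weight `k` to weight `k - i`. -/
def weightComp (i : ℕ) (D : Module.End R (Bar R A)) : Module.End R (Bar R A) :=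
  desc fun k => if i ≤ k then proj R A (k - i) ∘ₗ D ∘ₗ inc R A k else 0

theorem letterSign_of_mem (d : ℤ) {e : ℤ} {a : A} (ha : a ∈ 𝒜 e) :
    letterSign 𝒜 d a = ((d * (e - 1)).negOnePow : ℤ) • a := by
  simp only [letterSign, LinearMap.comp_apply, LinearEquiv.coe_coe,
    DirectSum.decomposeLinearEquiv_apply]
  rw [DirectSum.decompose_of_mem 𝒜 ha, ← DirectSum.lof_eq_of R, DirectSum.toModule_lof]
  rfl

theorem koszulSign_word (d : ℤ) {w : ℕ} (a : Fin (w + 1) → A) :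
    koszulSign 𝒜 d (word a) = word (fun k => letterSign 𝒜 d (a k)) := by
  simp only [koszulSign, word, desc_inc, LinearMap.comp_apply, PiTensorProduct.map_tprod]

end Grading

section WeightComponents

variable {R A : Type*} [CommRing R] [AddCommGroup A] [Module R A]
variable (𝒜 : ℤ → Submodule R A) [DirectSum.Decomposition 𝒜]

theorem proj_mul_proj (k l : ℕ) :
    proj R A k * proj R A l = if k = l then proj R A k else 0 := by
  refine hom_ext_word (R := R) (A := A) fun w a => ?_
  simp only [Module.End.mul_apply, proj_word]
  split_ifs with h1 h2 h2
  · subst h1; subst h2; simp [proj_word]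
  · subst h1; simp [proj_word, Ne.symm h2]
  · subst h2; simp [proj_word, h1]
  · simp

theorem koszulSign_mul_proj (d : ℤ) (k : ℕ) :
    koszulSign 𝒜 d * proj R A k = proj R A k * koszulSign 𝒜 d := by
  refine hom_ext_word (R := R) (A := A) fun w a => ?_
  simp only [Module.End.mul_apply, proj_word, koszulSign_word]
  split_ifs
  · rw [koszulSign_word]
  · simp

theorem exists_eq_sum_proj (x : Bar R A) :
    ∃ N, ∀ M, N ≤ M → x = ∑ k ∈ Finset.range M, proj R A k x := by
  induction x using bar_induction with
  | zero => exact ⟨0, fun M _ => by simp⟩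
  | inc w y =>
    refine ⟨w + 1, fun M hM => ?_⟩
    have : ∀ k, proj R A k (inc R A w y) = if w = k then inc R A w y else 0 := by
      intro k
      simp only [proj, LinearMap.comp_apply]
      split_ifs with h
      · subst h; rw [pr_inc_self]
      · rw [pr_inc_ne h, map_zero]
    simp only [this]
    rw [Finset.sum_ite_eq, if_pos (Finset.mem_range.2 (by omega))]
  | add x y hx hy =>
    obtain ⟨N, hN⟩ := hx
    obtain ⟨N', hN'⟩ := hy
    refine ⟨max N N', fun M hM => ?_⟩
    simp only [map_add, Finset.sum_add_distrib]
    rw [← hN M (le_trans (le_max_left _ _) hM), ← hN' M (le_trans (le_max_right _ _) hM)]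

theorem ext_proj {D E : Module.End R (Bar R A)}
    (h : ∀ l k, proj R A l * D * proj R A k = proj R A l * E * proj R A k) : D = E := by
  have h1 : ∀ k x, D (proj R A k x) = E (proj R A k x) := by
    intro k x
    obtain ⟨N, hN⟩ := exists_eq_sum_proj (D (proj R A k x))
    obtain ⟨N', hN'⟩ := exists_eq_sum_proj (E (proj R A k x))
    rw [hN _ (le_max_left N N'), hN' _ (le_max_right N N')]
    exact Finset.sum_congr rfl fun l _ => LinearMap.congr_fun (h l k) x
  refine LinearMap.ext fun x => ?_
  obtain ⟨N, hN⟩ := exists_eq_sum_proj x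
  rw [hN N le_rfl, map_sum, map_sum]
  exact Finset.sum_congr rfl fun k _ => h1 k x

theorem exists_eq_sum_proj_tmul (x : Bar R A ⊗[R] Bar R A) :
    ∃ N, ∀ M, N ≤ M → x = ∑ k ∈ Finset.range M, ∑ l ∈ Finset.range M,
      TensorProduct.map (proj R A k) (proj R A l) x := by
  induction x using TensorProduct.induction_on with
  | zero => exact ⟨0, fun M _ => by simp⟩
  | tmul x y =>
    obtain ⟨N, hN⟩ := exists_eq_sum_proj x
    obtain ⟨N', hN'⟩ := exists_eq_sum_proj y
    refine ⟨max N N', fun M hM => ?_⟩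
    simp only [TensorProduct.map_tmul]
    conv_lhs => rw [hN M (le_trans (le_max_left _ _) hM), hN' M (le_trans (le_max_right _ _) hM)]
    rw [TensorProduct.sum_tmul]
    exact Finset.sum_congr rfl fun k _ => by rw [TensorProduct.tmul_sum]
  | add x y hx hy =>
    obtain ⟨N, hN⟩ := hx
    obtain ⟨N', hN'⟩ := hy
    refine ⟨max N N', fun M hM => ?_⟩
    simp only [map_add, Finset.sum_add_distrib]
    rw [← hN M (le_trans (le_max_left _ _) hM), ← hN' M (le_trans (le_max_right _ _) hM)]

theorem tmul_eq_of_proj {x y : Bar R A ⊗[R] Bar R A}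
    (h : ∀ k l, TensorProduct.map (proj R A k) (proj R A l) x =
      TensorProduct.map (proj R A k) (proj R A l) y) : x = y := by
  obtain ⟨N, hN⟩ := exists_eq_sum_proj_tmul x
  obtain ⟨N', hN'⟩ := exists_eq_sum_proj_tmul y
  rw [hN _ (le_max_left N N'), hN' _ (le_max_right N N')]
  simp only [h]

theorem proj_comul (a b : ℕ) :
    TensorProduct.map (proj R A a) (proj R A b) ∘ₗ comul R A =
      TensorProduct.map (proj R A a) (proj R A b) ∘ₗ comul R A ∘ₗ proj R A (a + b + 1) := by
  refine hom_ext_word (M := Bar R A ⊗[R] Bar R A) fun w x => ?_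
  simp only [LinearMap.comp_apply, proj_word]
  split_ifs with h
  · rfl
  · simp only [comul_word, map_sum, TensorProduct.map_tmul, proj_word, map_zero]
    refine Finset.sum_eq_zero fun i _ => ?_
    split_ifs <;> first | omega | simp

theorem proj_comul_right (c b : ℕ) :
    TensorProduct.map LinearMap.id (proj R A b) ∘ₗ comul R A ∘ₗ proj R A (c + b + 1) =
      TensorProduct.map (proj R A c) (proj R A b) ∘ₗ comul R A := by
  refine hom_ext_word (M := Bar R A ⊗[R] Bar R A) fun w x => ?_
  simp only [LinearMap.comp_apply, proj_word]
  split_ifs with h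
  · simp only [comul_word, map_sum, TensorProduct.map_tmul, proj_word, LinearMap.id_apply]
    refine Finset.sum_congr rfl fun i _ => ?_
    split_ifs <;> first | omega | simp
  · simp only [comul_word, map_sum, TensorProduct.map_tmul, proj_word, map_zero]
    refine (Finset.sum_eq_zero fun i _ => ?_).symm
    split_ifs <;> first | omega | simp

theorem proj_comul_left (a c : ℕ) :
    TensorProduct.map (proj R A a) LinearMap.id ∘ₗ comul R A ∘ₗ proj R A (a + c + 1) =
      TensorProduct.map (proj R A a) (proj R A c) ∘ₗ comul R A := by
  refine hom_ext_word (M := Bar R A ⊗[R] Bar R A) fun w x => ?_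
  simp only [LinearMap.comp_apply, proj_word]
  split_ifs with h
  · simp only [comul_word, map_sum, TensorProduct.map_tmul, proj_word, LinearMap.id_apply]
    refine Finset.sum_congr rfl fun i _ => ?_
    split_ifs <;> first | omega | simp
  · simp only [comul_word, map_sum, TensorProduct.map_tmul, proj_word, map_zero]
    refine (Finset.sum_eq_zero fun i _ => ?_).symm
    split_ifs <;> first | omega | simp

theorem weightComp_mul_proj (i k : ℕ) (D : Module.End R (Bar R A)) :
    weightComp i D * proj R A k = if i ≤ k then proj R A (k - i) * D * proj R A k else 0 := by
  refine hom_ext_word (R := R) (A := A) fun w a => ?_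
  by_cases hk : w = k
  · subst hk
    have : weightComp i D (word a) =
        (if i ≤ w then proj R A (w - i) ∘ₗ D ∘ₗ inc R A w else 0) (PiTensorProduct.tprod R a) := by
      simp only [weightComp, word, desc_inc]
    split_ifs at this ⊢ <;>
      simp only [Module.End.mul_apply, proj_word, if_true, this] <;> rfl
  · split_ifs <;> simp [Module.End.mul_apply, proj_word, hk]

theorem proj_mul_weightComp (i j : ℕ) (D : Module.End R (Bar R A)) :
    proj R A j * weightComp i D = proj R A j * D * proj R A (j + i) := by
  refine ext_proj fun l k => ?_
  rw [mul_assoc, mul_assoc, weightComp_mul_proj, mul_assoc (proj R A l),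
    mul_assoc _ (proj R A (j + i)), proj_mul_proj (j + i) k]
  by_cases h : j + i = k
  · subst h
    rw [if_pos (by omega), if_pos rfl, Nat.add_sub_cancel, mul_assoc (proj R A j) D,
      ← mul_assoc (proj R A j) (proj R A j), proj_mul_proj, if_pos rfl]
  · rw [if_neg h]
    split_ifs with h'
    · rw [mul_assoc (proj R A (k - i)), ← mul_assoc (proj R A j) (proj R A (k - i)),
        proj_mul_proj, if_neg (by omega)]
      simp
    · simp

theorem proj_mem_degPart (k : ℕ) {p : ℤ} {x : Bar R A} (hx : x ∈ degPart 𝒜 p) :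
    proj R A k x ∈ degPart 𝒜 p := by
  refine (Submodule.span_le.2 ?_ : degPart 𝒜 p ≤ (degPart 𝒜 p).comap (proj R A k)) hx
  rintro _ ⟨w, a, e, ha, he, rfl⟩
  simp only [Submodule.comap_coe, Set.mem_preimage, SetLike.mem_coe, proj_word]
  split_ifs
  · exact Submodule.subset_span ⟨w, a, e, ha, he, rfl⟩
  · exact zero_mem _

/-- The weight components of a coderivation are coderivations of the same degree. -/
theorem weightComp_mem_Coder (i : ℕ) {d : ℤ} {D : Module.End R (Bar R A)} (hD : D ∈ Coder 𝒜 d) :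
    weightComp i D ∈ Coder 𝒜 d := by
  obtain ⟨hdeg, hco⟩ := hD
  refine ⟨fun p x hx => ?_, ?_⟩
  · obtain ⟨N, hN⟩ := exists_eq_sum_proj x
    rw [hN N le_rfl, map_sum]
    refine Submodule.sum_mem _ fun k _ => ?_
    change (weightComp i D * proj R A k) x ∈ _
    rw [weightComp_mul_proj]
    split_ifs
    · exact proj_mem_degPart 𝒜 _ (hdeg p _ (proj_mem_degPart 𝒜 _ hx))
    · exact zero_mem _
  · refine LinearMap.ext fun x => ?_
    refine tmul_eq_of_proj (R := R) (A := A) fun a b => ?_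
    have key : ∀ y, comul R A (D y) = TensorProduct.map D LinearMap.id (comul R A y) +
        TensorProduct.map (koszulSign 𝒜 d) D (comul R A y) := fun y => LinearMap.congr_fun hco y
    have h0 := LinearMap.congr_fun (proj_comul (R := R) (A := A) a b) (weightComp i D x)
    have h1 := LinearMap.congr_fun (proj_mul_weightComp (R := R) (A := A) i (a + b + 1) D) x
    have h2 := LinearMap.congr_fun (proj_comul (R := R) (A := A) a b)
      (D (proj R A (a + b + 1 + i) x))
    simp only [LinearMap.comp_apply, Module.End.mul_apply] at h0 h1 h2 ⊢
    rw [h0, h1, ← h2, key]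
    simp only [map_add, LinearMap.add_apply]
    congr 1
    · have e1 : TensorProduct.map (proj R A a) (proj R A b) ∘ₗ TensorProduct.map D LinearMap.id =
          TensorProduct.map (proj R A a * D) LinearMap.id ∘ₗ
            TensorProduct.map LinearMap.id (proj R A b) := by
        rw [← TensorProduct.map_comp, ← TensorProduct.map_comp]; rfl
      have e2 : TensorProduct.map (proj R A a) (proj R A b) ∘ₗ
            TensorProduct.map (weightComp i D) LinearMap.id =
          TensorProduct.map (proj R A a * D) LinearMap.id ∘ₗ
            TensorProduct.map (proj R A (a + i)) (proj R A b) := by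
        rw [← TensorProduct.map_comp, ← TensorProduct.map_comp]
        exact congrArg₂ _ (proj_mul_weightComp i a D) rfl
      have e3 := LinearMap.congr_fun (proj_comul_right (R := R) (A := A) (a + i) b) x
      have e1' := LinearMap.congr_fun e1 (comul R A (proj R A (a + b + 1 + i) x))
      have e2' := LinearMap.congr_fun e2 (comul R A x)
      simp only [LinearMap.comp_apply] at e1' e2' e3
      rw [e1', e2', ← e3, show a + i + b + 1 = a + b + 1 + i by ring]
    · have e1 : TensorProduct.map (proj R A a) (proj R A b) ∘ₗ
            TensorProduct.map (koszulSign 𝒜 d) D =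
          TensorProduct.map (koszulSign 𝒜 d) (proj R A b * D) ∘ₗ
            TensorProduct.map (proj R A a) LinearMap.id := by
        rw [← TensorProduct.map_comp, ← TensorProduct.map_comp]
        exact congrArg₂ _ (koszulSign_mul_proj 𝒜 d a).symm rfl
      have e2 : TensorProduct.map (proj R A a) (proj R A b) ∘ₗ
            TensorProduct.map (koszulSign 𝒜 d) (weightComp i D) =
          TensorProduct.map (koszulSign 𝒜 d) (proj R A b * D) ∘ₗ
            TensorProduct.map (proj R A a) (proj R A (b + i)) := by
        rw [← TensorProduct.map_comp, ← TensorProduct.map_comp]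
        exact congrArg₂ _ (koszulSign_mul_proj 𝒜 d a).symm (proj_mul_weightComp i b D)
      have e3 := LinearMap.congr_fun (proj_comul_left (R := R) (A := A) a (b + i)) x
      have e1' := LinearMap.congr_fun e1 (comul R A (proj R A (a + b + 1 + i) x))
      have e2' := LinearMap.congr_fun e2 (comul R A x)
      simp only [LinearMap.comp_apply] at e1' e2' e3
      rw [e1', e2', ← e3, show a + (b + i) + 1 = a + b + 1 + i by ring]

theorem weightComp_mem_weightFil (i : ℕ) (D : Module.End R (Bar R A)) :
    weightComp i D ∈ weightFil R A i := by
  intro k l h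
  rw [proj_mul_weightComp, mul_assoc, proj_mul_proj, if_neg (by omega), mul_zero]

theorem weightFil_antitone {p q : ℕ} (h : p ≤ q) : weightFil R A q ≤ weightFil R A p :=
  fun _ hD k l hkl => hD k l (by omega)


theorem mul_mem_weightFil {p q : ℕ} {D E : Module.End R (Bar R A)} (hD : D ∈ weightFil R A p)
    (hE : E ∈ weightFil R A q) : D * E ∈ weightFil R A (p + q) := by
  intro k l h
  refine LinearMap.ext fun x => ?_
  simp only [Module.End.mul_apply]
  obtain ⟨N, hN⟩ := exists_eq_sum_proj (E (proj R A k x))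
  rw [hN N le_rfl, map_sum, map_sum]
  refine Finset.sum_eq_zero fun m _ => ?_
  by_cases hm : m < l + p
  · exact LinearMap.congr_fun (hD m l hm) _
  · have := LinearMap.congr_fun (hE k m (by omega)) x
    simp only [Module.End.mul_apply] at this
    rw [this]; simp

theorem proj_mul_weightComp_mul_proj (i l k : ℕ) (D : Module.End R (Bar R A)) :
    proj R A l * weightComp i D * proj R A k =
      if k = l + i then proj R A l * D * proj R A k else 0 := by
  rw [proj_mul_weightComp, mul_assoc, proj_mul_proj]
  split_ifs with h1 h2 h2
  · rw [h1]
  · omega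
  · omega
  · rw [mul_zero]

/-- For endomorphisms that do not raise the weight, the weight components of a composite are given
by the Cauchy product. -/
theorem sum_weightComp_mul {D E : Module.End R (Bar R A)} (hD : D ∈ weightFil R A 0)
    (hE : E ∈ weightFil R A 0) (w : ℕ) :
    ∑ ij ∈ Finset.HasAntidiagonal.antidiagonal w, weightComp ij.1 D * weightComp ij.2 E = weightComp w (D * E) := by
  refine ext_proj fun l k => ?_
  rw [proj_mul_weightComp_mul_proj, Finset.mul_sum, Finset.sum_mul]
  have h1 : ∀ ij ∈ Finset.HasAntidiagonal.antidiagonal w,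
      proj R A l * (weightComp ij.1 D * weightComp ij.2 E) * proj R A k =
      if k = l + w then proj R A l * D * (proj R A (l + ij.1) * E * proj R A k) else 0 := by
    intro ij hij
    rw [Finset.HasAntidiagonal.mem_antidiagonal] at hij
    rw [← mul_assoc, proj_mul_weightComp, mul_assoc (proj R A l * D), mul_assoc (proj R A l * D),
      proj_mul_weightComp_mul_proj, add_assoc, hij, mul_ite, mul_zero]
  rw [Finset.sum_congr rfl h1]
  split_ifs with hk
  · subst hk
    rw [Finset.Nat.sum_antidiagonal_eq_sum_range_succ_mk]
    refine LinearMap.ext fun x => ?_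
    simp only [LinearMap.sum_apply, Module.End.mul_apply]
    obtain ⟨N, hN⟩ := exists_eq_sum_proj (E (proj R A (l + w) x))
    conv_rhs => rw [hN (max N (l + w + 1)) (le_max_left _ _), map_sum, map_sum]
    rw [Finset.sum_image (s := Finset.range (w + 1)) (g := fun i => l + i)
      (f := fun m => proj R A l (D (proj R A m (E (proj R A (l + w) x)))))
      (fun a _ b _ h => by simpa using h) |>.symm]
    refine Finset.sum_subset (fun m hm => ?_) (fun m _ hm => ?_)
    · obtain ⟨i, hi, rfl⟩ := Finset.mem_image.1 hm
      rw [Finset.mem_range] at hi ⊢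
      exact lt_of_lt_of_le (by omega) (le_max_right _ _)
    · by_cases hml : m < l
      · exact LinearMap.congr_fun (hD m l (by omega)) _
      · have hm' : l + w < m := by
          by_contra h
          exact hm (Finset.mem_image.2 ⟨m - l, Finset.mem_range.2 (by omega), by omega⟩)
        have := LinearMap.congr_fun (hE (l + w) m (by omega)) x
        simp only [Module.End.mul_apply] at this
        rw [this]; simp
  · simp

end WeightComponents

section Cohomology

variable {R A : Type*} [CommRing R] [AddCommGroup A] [Module R A]
variable (𝒜 : ℤ → Submodule R A) [DirectSum.Decomposition 𝒜]

/-- A minimal `R`-linear `A_∞`-algebra structure on the graded `R`-module `A = ⨁ 𝒜 e`: a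
codifferential `Q` (a coderivation of degree `1` with `Q ∘ Q = 0`) on the cofree coalgebra
`Bar R A`, without component of weight `0`, i.e. with zero differential on `A`. -/
structure MinimalAInfinity where
  /-- The codifferential. -/
  Q : Module.End R (Bar R A)
  mem_Coder : Q ∈ Coder 𝒜 1
  sq_zero : Q * Q = 0
  mem_weightFil : Q ∈ weightFil R A 1

namespace MinimalAInfinity

variable {𝒜} (S : MinimalAInfinity 𝒜)

/-- The component `q_i` of weight `i` of the codifferential `Q = q_1 + q_2 + ⋯`. -/
def q (i : ℕ) : Module.End R (Bar R A) := weightComp i S.Q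

/-- The differential `[Q, D] = Q D - (-1)^d D Q` on coderivations of degree `d`. -/
def diff (d : ℤ) : Module.End R (Bar R A) →ₗ[R] Module.End R (Bar R A) where
  toFun D := S.Q * D - (d.negOnePow : ℤ) • (D * S.Q)
  map_add' D E := by rw [mul_add, add_mul, smul_add]; abel
  map_smul' r D := by
    rw [mul_smul_comm, smul_mul_assoc, smul_comm _ r (D * S.Q), RingHom.id_apply, smul_sub]

/-- Degree `d` cocycles of the Hochschild complex `(Coder, [Q, -])`. -/
def hochCocycles (d : ℤ) : Submodule R (Module.End R (Bar R A)) :=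
  Coder 𝒜 d ⊓ LinearMap.ker (S.diff d)

/-- Degree `d` coboundaries of the Hochschild complex `(Coder, [Q, -])`. -/
def hochCoboundaries (d : ℤ) : Submodule R (Module.End R (Bar R A)) :=
  (Coder 𝒜 (d - 1)).map (S.diff (d - 1))

/-- The Hochschild (i.e. operadic) cohomology of the `A_∞`-algebra in degree `d`. -/
abbrev HochschildCohomology (d : ℤ) : Type _ :=
  S.hochCocycles d ⧸ (S.hochCoboundaries d).submoduleOf (S.hochCocycles d)

/-- Representatives in `F^p Coder` of the degree `d` cocycles of `F^p Coder / F^r Coder`. -/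
def truncCocycles (p r : ℕ) (d : ℤ) : Submodule R (Module.End R (Bar R A)) :=
  (Coder 𝒜 d ⊓ weightFil R A p) ⊓ (weightFil R A r).comap (S.diff d)

/-- Representatives in `F^p Coder` of the degree `d` coboundaries of `F^p Coder / F^r Coder`. -/
def truncCoboundaries (p r : ℕ) (d : ℤ) : Submodule R (Module.End R (Bar R A)) :=
  (Coder 𝒜 (d - 1) ⊓ weightFil R A p).map (S.diff (d - 1)) ⊔ (Coder 𝒜 d ⊓ weightFil R A r)

/-- The cohomology in degree `d` of the quotient complex `F^p Coder / F^r Coder`. -/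
abbrev TruncCohomology (p r : ℕ) (d : ℤ) : Type _ :=
  S.truncCocycles p r d ⧸ (S.truncCoboundaries p r d).submoduleOf (S.truncCocycles p r d)

/-- `Q̃^{≤ n} = q_2 + 2 q_3 + ⋯ + (n - 1) q_n`. -/
def truncatedKaledinCocycle (n : ℕ) : Module.End R (Bar R A) :=
  ∑ i ∈ Finset.Icc 2 n, ((i : R) - 1) • S.q i

theorem q_mem_Coder (i : ℕ) : S.q i ∈ Coder 𝒜 1 := weightComp_mem_Coder 𝒜 i S.mem_Coder

theorem q_mem_weightFil (i : ℕ) : S.q i ∈ weightFil R A i := weightComp_mem_weightFil i S.Q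

theorem q_zero : S.q 0 = 0 := by
  refine ext_proj fun l k => ?_
  rw [q, proj_mul_weightComp_mul_proj]
  split_ifs with h
  · rw [S.mem_weightFil k l (by omega)]; simp
  · simp

theorem sum_q_mul_q (w : ℕ) : ∑ ij ∈ Finset.HasAntidiagonal.antidiagonal w, S.q ij.1 * S.q ij.2 = 0 := by
  have h0 : S.Q ∈ weightFil R A 0 := weightFil_antitone (Nat.zero_le 1) S.mem_weightFil
  unfold q
  rw [sum_weightComp_mul h0 h0, S.sq_zero]
  refine ext_proj fun l k => ?_
  rw [proj_mul_weightComp_mul_proj]; simp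

theorem diff_one_apply (D : Module.End R (Bar R A)) : S.diff 1 D = S.Q * D + D * S.Q := by
  simp [diff]

theorem truncatedKaledinCocycle_mem (n : ℕ) :
    S.truncatedKaledinCocycle n ∈ S.truncCocycles 1 (n + 1) 1 := by
  refine ⟨⟨?_, ?_⟩, ?_⟩
  · exact Submodule.sum_mem _ fun i _ => Submodule.smul_mem _ _ (S.q_mem_Coder i)
  · refine Submodule.sum_mem _ fun i hi => Submodule.smul_mem _ _ ?_
    rw [Finset.mem_Icc] at hi
    exact weightFil_antitone (by omega) (S.q_mem_weightFil i)
  · change S.diff 1 (S.truncatedKaledinCocycle n) ∈ weightFil R A (n + 1)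
    -- the weight operator, which scales the weight `w` part by `w`
    let W : Module.End R (Bar R A) := desc fun w => (w : R) • inc R A w
    have hWr : ∀ k, W * proj R A k = (k : R) • proj R A k := by
      intro k
      refine LinearMap.ext fun x => ?_
      simp only [W, proj, Module.End.mul_apply, LinearMap.comp_apply, desc_inc,
        LinearMap.smul_apply]
    have hWl : ∀ k, proj R A k * W = (k : R) • proj R A k := by
      intro k
      refine ext_proj fun a b => ?_
      rw [mul_assoc, mul_assoc, hWr, mul_smul_comm, proj_mul_proj, mul_smul_comm, mul_smul_comm,
        smul_mul_assoc, mul_assoc, proj_mul_proj]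
      split_ifs with h
      · rw [h]
      · simp
    let K := S.Q * W - W * S.Q - S.Q
    have hK : S.Q * K + K * S.Q = 0 := by
      simp only [K, mul_sub, sub_mul, mul_assoc, S.sq_zero, mul_zero]
      simp only [← mul_assoc, S.sq_zero, zero_mul]
      abel
    have hd : S.truncatedKaledinCocycle n - K ∈ weightFil R A (n + 1) := by
      intro k l h
      have e1 : proj R A l * K * proj R A k =
          ((k : R) - l - 1) • (proj R A l * S.Q * proj R A k) := by
        have f1 : proj R A l * (S.Q * W) * proj R A k = (k : R) • (proj R A l * S.Q * proj R A k) := by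
          rw [mul_assoc, mul_assoc, hWr, mul_smul_comm, mul_smul_comm, mul_assoc]
        have f2 : proj R A l * (W * S.Q) * proj R A k = (l : R) • (proj R A l * S.Q * proj R A k) := by
          rw [← mul_assoc, hWl, smul_mul_assoc, smul_mul_assoc]
        simp only [K, mul_sub, sub_mul, f1, f2, sub_smul, one_smul]
      have e2 : proj R A l * S.truncatedKaledinCocycle n * proj R A k =
          ∑ i ∈ Finset.Icc 2 n, if k = l + i then
            ((i : R) - 1) • (proj R A l * S.Q * proj R A k) else 0 := by
        rw [truncatedKaledinCocycle, Finset.mul_sum, Finset.sum_mul]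
        refine Finset.sum_congr rfl fun i _ => ?_
        rw [mul_smul_comm, smul_mul_assoc, q, proj_mul_weightComp_mul_proj]
        split_ifs <;> simp
      rw [mul_sub, sub_mul, e1, e2]
      by_cases hk : k < l + 1
      · rw [S.mem_weightFil k l hk]; simp
      · obtain ⟨j, rfl⟩ : ∃ j, k = l + j := ⟨k - l, by omega⟩
        simp only [Nat.add_left_cancel_iff]
        rw [Finset.sum_ite_eq]
        split_ifs with hj
        · push_cast; rw [add_sub_cancel_left, sub_self]
        · rw [Finset.mem_Icc] at hj
          have : j = 1 := by omega
          subst this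
          push_cast
          simp
    have : S.diff 1 (S.truncatedKaledinCocycle n) =
        S.diff 1 (S.truncatedKaledinCocycle n - K) := by
      rw [map_sub, S.diff_one_apply K, hK, sub_zero]
    rw [this, diff_one_apply]
    refine add_mem ?_ ?_
    · exact weightFil_antitone (by omega) (mul_mem_weightFil S.mem_weightFil hd)
    · exact weightFil_antitone (by omega) (mul_mem_weightFil hd S.mem_weightFil)

/-- The truncated operadic Kaledin class
`K_A^{≤ n} = [q_2 + 2 q_3 + ⋯ + (n - 1) q_n] ∈ H¹(F¹ Coder / F^{n + 1} Coder)`. -/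
def truncatedKaledinClass (n : ℕ) : S.TruncCohomology 1 (n + 1) 1 :=
  Submodule.Quotient.mk ⟨S.truncatedKaledinCocycle n, S.truncatedKaledinCocycle_mem n⟩

end MinimalAInfinity

end Cohomology

section BaseChange

variable (K S : Type*) {A : Type*} [Field K] [CommRing S] [Algebra K S] [AddCommGroup A] [Module K A]

/-- The canonical map `Bar K A → Bar S (S ⊗ A)`, `a₀ ⊗ ⋯ ⊗ a_w ↦ (1 ⊗ a₀) ⊗ ⋯ ⊗ (1 ⊗ a_w)`. -/
def incl : Bar K A →ₗ[K] Bar S (S ⊗[K] A) :=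
  desc fun w => (inc S (S ⊗[K] A) w).restrictScalars K ∘ₗ
    PiTensorProduct.lift (((PiTensorProduct.tprod S).restrictScalars K).compLinearMap
      fun _ : Fin (w + 1) => TensorProduct.mk K S A 1)

/-- The `S`-linear isomorphism `S ⊗ A^{⊗ n} ≅ (S ⊗ A)^{⊗_S n}`, in the direction from right to left,
obtained from the corresponding map of tensor algebras. -/
def tensorPowerBaseChange (n : ℕ) : ⨂[S]^n (S ⊗[K] A) →ₗ[S] S ⊗[K] (⨂[K]^n A) :=
  ((DirectSum.component K ℕ (fun n => ⨂[K]^n A) n ∘ₗ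
      (TensorAlgebra.toDirectSum (R := K) (M := A)).toLinearMap).baseChange S) ∘ₗ
    (TensorAlgebra.lift S ((TensorAlgebra.ι K (M := A)).baseChange S)).toLinearMap ∘ₗ
    TensorPower.toTensorAlgebra

/-- The canonical isomorphism `Bar S (S ⊗ A) → S ⊗ Bar K A`. -/
def toBaseChange : Bar S (S ⊗[K] A) →ₗ[S] S ⊗[K] Bar K A :=
  desc fun w => (inc K A w).baseChange S ∘ₗ tensorPowerBaseChange K S (w + 1)

variable {K}

/-- The `S`-linear extension `Bar S (S ⊗ A) → M` of a `K`-linear map `Bar K A → M`, i.e. the unique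
`S`-linear map that restricts to it along `incl`. -/
def extend {M : Type*} [AddCommGroup M] [Module K M] [Module S M] [IsScalarTower K S M]
    (f : Bar K A →ₗ[K] M) : Bar S (S ⊗[K] A) →ₗ[S] M :=
  f.liftBaseChange S ∘ₗ toBaseChange K S

/-- The base change of an endomorphism of `Bar K A` to `Bar S (S ⊗ A)`. -/
def baseChangeEnd (D : Module.End K (Bar K A)) : Module.End S (Bar S (S ⊗[K] A)) :=
  extend S (incl K S ∘ₗ D)

variable (K)

theorem incl_word {w : ℕ} (a : Fin (w + 1) → A) :
    incl K S (word a) = word fun k => (1 : S) ⊗ₜ[K] a k := by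
  simp only [incl, word, desc_inc, LinearMap.comp_apply, PiTensorProduct.lift.tprod]
  rfl

theorem tensorPowerBaseChange_tprod (n : ℕ) (a : Fin n → A) :
    tensorPowerBaseChange K S n (PiTensorProduct.tprod S fun k => (1 : S) ⊗ₜ[K] a k) =
      1 ⊗ₜ PiTensorProduct.tprod K a := by
  have h : ∀ l : List A, (TensorAlgebra.lift S ((TensorAlgebra.ι K (M := A)).baseChange S))
      ((l.map fun a => TensorAlgebra.ι S ((1 : S) ⊗ₜ[K] a)).prod) =
      (1 : S) ⊗ₜ[K] ((l.map (TensorAlgebra.ι K)).prod) := by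
    intro l
    induction l with
    | nil => simp [Algebra.TensorProduct.one_def]
    | cons a l ih =>
      rw [List.map_cons, List.prod_cons, map_mul, ih, TensorAlgebra.lift_ι_apply,
        LinearMap.baseChange_tmul, Algebra.TensorProduct.tmul_mul_tmul, mul_one, List.map_cons,
        List.prod_cons]
  have h' := h (List.ofFn a)
  simp only [tensorPowerBaseChange, LinearMap.comp_apply, TensorPower.toTensorAlgebra_tprod,
    AlgHom.toLinearMap_apply, TensorAlgebra.tprod_apply]
  rw [List.map_ofFn, List.map_ofFn] at h'
  have h1 : (List.ofFn fun i => TensorAlgebra.ι S ((1 : S) ⊗ₜ[K] a i)) =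
    List.ofFn ((fun a => TensorAlgebra.ι S ((1 : S) ⊗ₜ[K] a)) ∘ a) := rfl
  rw [h1, h', LinearMap.baseChange_tmul]
  congr 1
  have h2 := TensorAlgebra.toDirectSum_tensorPower_tprod (R := K) a
  rw [TensorAlgebra.tprod_apply] at h2
  simp only [LinearMap.comp_apply, AlgHom.toLinearMap_apply]
  erw [h2]
  rw [← DirectSum.lof_eq_of K, DirectSum.component.lof_self]

theorem toBaseChange_incl (x : Bar K A) : toBaseChange K S (incl K S x) = 1 ⊗ₜ x := by
  have : (toBaseChange K S).restrictScalars K ∘ₗ incl K S = TensorProduct.mk K S (Bar K A) 1 := by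
    refine hom_ext_word fun w a => ?_
    simp only [LinearMap.comp_apply, LinearMap.restrictScalars_apply, incl_word, toBaseChange]
    rw [word, desc_inc, LinearMap.comp_apply, tensorPowerBaseChange_tprod,
      LinearMap.baseChange_tmul]
    rfl
  exact LinearMap.congr_fun this x

variable {K}

theorem extend_incl {M : Type*} [AddCommGroup M] [Module K M] [Module S M] [IsScalarTower K S M]
    (f : Bar K A →ₗ[K] M) (x : Bar K A) : extend S f (incl K S x) = f x := by
  rw [extend, LinearMap.comp_apply, toBaseChange_incl, LinearMap.liftBaseChange_tmul, one_smul]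

theorem baseChangeEnd_incl (D : Module.End K (Bar K A)) (x : Bar K A) :
    baseChangeEnd S D (incl K S x) = incl K S (D x) := extend_incl S _ x

theorem hom_ext_incl {M : Type*} [AddCommGroup M] [Module S M]
    {f g : Bar S (S ⊗[K] A) →ₗ[S] M} (h : ∀ x : Bar K A, f (incl K S x) = g (incl K S x)) :
    f = g := by
  refine bar_hom_ext fun w => PiTensorProduct.ext ?_
  let b := Module.Basis.ofVectorSpace K A
  refine Module.Basis.ext_multilinear (fun _ => Algebra.TensorProduct.basis S b) fun v => ?_
  simp only [Algebra.TensorProduct.basis_apply]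
  have := h (word fun k => b (v k))
  rw [incl_word] at this
  exact this


variable (𝒜 : ℤ → Submodule K A) [DirectSum.Decomposition 𝒜]

/-- The base change of a graded module: the piece of degree `e` is `S ⊗ 𝒜 e`. -/
abbrev gradingBaseChange : ℤ → Submodule S (S ⊗[K] A) := fun e => (𝒜 e).baseChange S

theorem proj_incl (k : ℕ) (x : Bar K A) :
    proj S (S ⊗[K] A) k (incl K S x) = incl K S (proj K A k x) := by
  have : (proj S (S ⊗[K] A) k).restrictScalars K ∘ₗ incl K S = incl K S ∘ₗ proj K A k := by
    refine hom_ext_word fun w a => ?_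
    simp only [LinearMap.comp_apply, LinearMap.restrictScalars_apply, incl_word, proj_word]
    split_ifs
    · rw [incl_word]
    · simp
  exact LinearMap.congr_fun this x

theorem proj_baseChangeEnd_proj (l k : ℕ) (D : Module.End K (Bar K A)) :
    proj S (S ⊗[K] A) l * baseChangeEnd S D * proj S (S ⊗[K] A) k =
      baseChangeEnd S (proj K A l * D * proj K A k) := by
  refine hom_ext_incl S fun x => ?_
  simp only [Module.End.mul_apply, proj_incl, baseChangeEnd_incl]

theorem baseChangeEnd_zero : baseChangeEnd S (0 : Module.End K (Bar K A)) = 0 := by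
  refine hom_ext_incl S fun x => ?_
  simp only [baseChangeEnd_incl, LinearMap.zero_apply, map_zero]

theorem baseChangeEnd_mul (D E : Module.End K (Bar K A)) :
    baseChangeEnd S (D * E) = baseChangeEnd S D * baseChangeEnd S E := by
  refine hom_ext_incl S fun x => ?_
  simp only [baseChangeEnd_incl, Module.End.mul_apply]

theorem baseChangeEnd_sum {ι : Type*} (s : Finset ι) (D : ι → Module.End K (Bar K A)) :
    baseChangeEnd S (∑ i ∈ s, D i) = ∑ i ∈ s, baseChangeEnd S (D i) := by
  refine hom_ext_incl S fun x => ?_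
  simp only [baseChangeEnd_incl, LinearMap.sum_apply, map_sum]

theorem baseChangeEnd_mem_weightFil {p : ℕ} {D : Module.End K (Bar K A)}
    (hD : D ∈ weightFil K A p) : baseChangeEnd S D ∈ weightFil S (S ⊗[K] A) p := by
  intro k l h
  rw [proj_baseChangeEnd_proj, hD k l h, baseChangeEnd_zero]

theorem koszulSign_incl (d : ℤ) (x : Bar K A) :
    koszulSign (gradingBaseChange S 𝒜) d (incl K S x) = incl K S (koszulSign 𝒜 d x) := by
  have h1 : ∀ a : A, letterSign (gradingBaseChange S 𝒜) d ((1 : S) ⊗ₜ[K] a) =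
      (1 : S) ⊗ₜ[K] letterSign 𝒜 d a := by
    intro a
    induction a using DirectSum.Decomposition.inductionOn 𝒜 with
    | zero => simp
    | homogeneous m =>
      rw [letterSign_of_mem _ d m.2,
        letterSign_of_mem (gradingBaseChange S 𝒜) d (Submodule.tmul_mem_baseChange_of_mem 1 m.2)]
      simp only [TensorProduct.tmul_smul]
    | add a b ha hb => rw [TensorProduct.tmul_add, map_add, ha, hb, map_add, TensorProduct.tmul_add]
  have : (koszulSign (gradingBaseChange S 𝒜) d).restrictScalars K ∘ₗ incl K S =
      incl K S ∘ₗ koszulSign 𝒜 d := by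
    refine hom_ext_word fun w a => ?_
    simp only [LinearMap.comp_apply, LinearMap.restrictScalars_apply, incl_word, koszulSign_word, h1]
  exact LinearMap.congr_fun this x

variable (K A) in
/-- The canonical map `Bar K A ⊗ Bar K A → Bar S (S ⊗ A) ⊗ Bar S (S ⊗ A)`. -/
def incl₂ : Bar K A ⊗[K] Bar K A →ₗ[K] Bar S (S ⊗[K] A) ⊗[S] Bar S (S ⊗[K] A) :=
  TensorProduct.lift (LinearMap.mk₂ K (fun x y => incl K S x ⊗ₜ[S] incl K S y)
    (fun x x' y => by rw [map_add, TensorProduct.add_tmul])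
    (fun r x y => by rw [map_smul, TensorProduct.smul_tmul'])
    (fun x y y' => by rw [map_add, TensorProduct.tmul_add])
    (fun r x y => by rw [map_smul, TensorProduct.tmul_smul]))

theorem incl₂_tmul (x y : Bar K A) : incl₂ K S A (x ⊗ₜ y) = incl K S x ⊗ₜ[S] incl K S y := rfl

theorem comul_incl (x : Bar K A) :
    comul S (S ⊗[K] A) (incl K S x) = incl₂ K S A (comul K A x) := by
  have : (comul S (S ⊗[K] A)).restrictScalars K ∘ₗ incl K S = incl₂ K S A ∘ₗ comul K A := by
    refine hom_ext_word fun w a => ?_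
    simp only [LinearMap.comp_apply, LinearMap.restrictScalars_apply, incl_word, comul_word,
      map_sum, incl₂_tmul]
  exact LinearMap.congr_fun this x

theorem map_incl₂ {D E : Module.End K (Bar K A)} {D' E' : Module.End S (Bar S (S ⊗[K] A))}
    (hD : ∀ x, D' (incl K S x) = incl K S (D x)) (hE : ∀ x, E' (incl K S x) = incl K S (E x))
    (x : Bar K A ⊗[K] Bar K A) :
    TensorProduct.map D' E' (incl₂ K S A x) = incl₂ K S A (TensorProduct.map D E x) := by
  induction x using TensorProduct.induction_on with
  | zero => simp
  | tmul x y => simp only [incl₂_tmul, TensorProduct.map_tmul, hD, hE]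
  | add x y hx hy => simp only [map_add, hx, hy]

theorem incl_mem_degPart {p : ℤ} {x : Bar K A} (hx : x ∈ degPart 𝒜 p) :
    incl K S x ∈ degPart (gradingBaseChange S 𝒜) p := by
  refine (Submodule.span_le.2 ?_ : degPart 𝒜 p ≤
    ((degPart (gradingBaseChange S 𝒜) p).restrictScalars K).comap (incl K S)) hx
  rintro _ ⟨w, a, e, ha, he, rfl⟩
  change incl K S (word a) ∈ degPart (gradingBaseChange S 𝒜) p
  rw [incl_word]
  exact Submodule.subset_span
    ⟨w, _, e, fun k => Submodule.tmul_mem_baseChange_of_mem 1 (ha k), he, rfl⟩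

/-- An `S`-linear map sends degree `p` into a given submodule as soon as it does so on the image of
the degree `p` part of `Bar K A`. -/
theorem apply_mem_of_incl {M : Type*} [AddCommGroup M] [Module S M] (N : Submodule S M)
    (f : Bar S (S ⊗[K] A) →ₗ[S] M) (p : ℤ) (h : ∀ x ∈ degPart 𝒜 p, f (incl K S x) ∈ N)
    {y : Bar S (S ⊗[K] A)} (hy : y ∈ degPart (gradingBaseChange S 𝒜) p) : f y ∈ N := by
  refine (Submodule.span_le.2 ?_ : degPart (gradingBaseChange S 𝒜) p ≤ N.comap f) hy
  rintro _ ⟨w, a, e, ha, he, rfl⟩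
  choose b hb using fun k => Submodule.toBaseChange_surjective S (𝒜 (e k)) ⟨a k, ha k⟩
  have hb' : ∀ k, a k = ((𝒜 (e k)).toBaseChange S (b k) : S ⊗[K] A) := fun k => by rw [hb k]
  let g : MultilinearMap S (fun k => S ⊗[K] (𝒜 (e k))) (M ⧸ N) :=
    ((N.mkQ ∘ₗ f ∘ₗ inc S (S ⊗[K] A) w).compMultilinearMap
      (PiTensorProduct.tprod S)).compLinearMap
      fun k => ((𝒜 (e k)).baseChange S).subtype ∘ₗ (𝒜 (e k)).toBaseChange S
  have hg : g = 0 := by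
    refine Module.Basis.ext_multilinear
      (fun k => Algebra.TensorProduct.basis S (Module.Basis.ofVectorSpace K (𝒜 (e k)))) fun v => ?_
    simp only [Algebra.TensorProduct.basis_apply, zero_apply]
    change N.mkQ (f (word fun k => ((𝒜 (e k)).toBaseChange S
      ((1 : S) ⊗ₜ[K] (Module.Basis.ofVectorSpace K (𝒜 (e k)) (v k))) : S ⊗[K] A))) = 0
    simp only [Submodule.coe_toBaseChange_tmul, Submodule.mkQ_apply]
    rw [Submodule.Quotient.mk_eq_zero, ← incl_word]
    exact h _ (Submodule.subset_span ⟨w, _, e, fun k => Subtype.mem _, he, rfl⟩)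
  have := congrArg (fun g => g b) hg
  change N.mkQ (f (word fun k => ((𝒜 (e k)).toBaseChange S (b k) : S ⊗[K] A))) = 0 at this
  simp only [← hb'] at this
  rwa [Submodule.mkQ_apply, Submodule.Quotient.mk_eq_zero] at this

/-- The base change of a coderivation is a coderivation of the same degree. -/
theorem baseChangeEnd_mem_Coder {d : ℤ} {D : Module.End K (Bar K A)} (hD : D ∈ Coder 𝒜 d) :
    baseChangeEnd S D ∈ Coder (gradingBaseChange S 𝒜) d := by
  obtain ⟨hdeg, hco⟩ := hD
  refine ⟨fun p y hy => ?_, ?_⟩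
  · refine apply_mem_of_incl S 𝒜 _ (baseChangeEnd S D) p (fun x hx => ?_) hy
    rw [baseChangeEnd_incl]
    exact incl_mem_degPart S 𝒜 (hdeg p x hx)
  · refine hom_ext_incl S fun x => ?_
    have hx := LinearMap.congr_fun hco x
    simp only [LinearMap.comp_apply, LinearMap.add_apply] at hx ⊢
    rw [baseChangeEnd_incl, comul_incl, hx, comul_incl, map_add,
      map_incl₂ S (baseChangeEnd_incl S D) (E := LinearMap.id) (fun _ => rfl),
      map_incl₂ S (koszulSign_incl S 𝒜 d) (baseChangeEnd_incl S D)]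

end BaseChange

section Deformation

variable (K : Type*) [Field K]

/-- The truncated polynomial ring `K[h] / h^n`. -/
def Trunc (n : ℕ) : Type _ := K[X] ⧸ Ideal.span {(Polynomial.X : K[X]) ^ n}

instance (n : ℕ) : CommRing (Trunc K n) :=
  inferInstanceAs (CommRing (K[X] ⧸ Ideal.span {(Polynomial.X : K[X]) ^ n}))

instance (n : ℕ) : Algebra K (Trunc K n) :=
  inferInstanceAs (Algebra K (K[X] ⧸ Ideal.span {(Polynomial.X : K[X]) ^ n}))

/-- The quotient map `K[h] → K[h] / h^n`. -/
def truncMk (n : ℕ) : K[X] →ₐ[K] Trunc K n :=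
  Ideal.Quotient.mkₐ K (Ideal.span {(Polynomial.X : K[X]) ^ n})

theorem truncMk_eq_zero {n : ℕ} {f : K[X]} : truncMk K n f = 0 ↔ Polynomial.X ^ n ∣ f :=
  Ideal.Quotient.eq_zero_iff_mem.trans Ideal.mem_span_singleton

/-- The class of the variable `h` in `K[h] / h^n`. -/
def hvar (n : ℕ) : Trunc K n := truncMk K n Polynomial.X

theorem hvar_pow_self (n : ℕ) : hvar K n ^ n = 0 := by
  rw [hvar, ← map_pow, truncMk_eq_zero]

/-- The formal derivative with respect to `h`, as a `K`-linear map `K[h] / h^(n+1) → K[h] / h^n`. -/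
def truncDeriv (n : ℕ) : Trunc K (n + 1) →ₗ[K] Trunc K n :=
  ((Ideal.span {(Polynomial.X : K[X]) ^ (n + 1)}).restrictScalars K).liftQ
    ((truncMk K n).toLinearMap ∘ₗ Polynomial.derivative) (by
    intro f hf
    obtain ⟨g, rfl⟩ := Ideal.mem_span_singleton'.1 (show f ∈ Ideal.span _ from hf)
    change truncMk K n (Polynomial.derivative (g * Polynomial.X ^ (n + 1))) = 0
    rw [truncMk_eq_zero, Polynomial.derivative_mul, Polynomial.derivative_X_pow]
    refine dvd_add ?_ ?_
    · exact Dvd.dvd.mul_left (pow_dvd_pow _ (Nat.le_succ n)) _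
    · exact Dvd.dvd.mul_left (by simp) _)

theorem truncDeriv_mk (n : ℕ) (f : K[X]) :
    truncDeriv K n (truncMk K (n + 1) f) = truncMk K n (Polynomial.derivative f) := rfl

theorem truncDeriv_hvar_pow (n i : ℕ) :
    truncDeriv K n (hvar K (n + 1) ^ i) = (i : Trunc K n) * hvar K n ^ (i - 1) := by
  rw [hvar, ← map_pow, truncDeriv_mk, Polynomial.derivative_X_pow]
  simp [hvar]

theorem cauchy_mul {S E : Type*} [CommRing S] [Ring E] [Algebra S E] {n : ℕ} {h : S}
    (hn : h ^ n = 0) (a b : ℕ → E) :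
    (∑ i ∈ Finset.range n, h ^ i • a i) * (∑ j ∈ Finset.range n, h ^ j • b j) =
      ∑ s ∈ Finset.range n, h ^ s •
        ∑ ij ∈ Finset.HasAntidiagonal.antidiagonal s, a ij.1 * b ij.2 := by
  have h1 : (∑ i ∈ Finset.range n, h ^ i • a i) * (∑ j ∈ Finset.range n, h ^ j • b j) =
      ∑ x ∈ Finset.range n ×ˢ Finset.range n, h ^ (x.1 + x.2) • (a x.1 * b x.2) := by
    rw [Finset.sum_mul_sum, Finset.sum_product]
    refine Finset.sum_congr rfl fun i _ => Finset.sum_congr rfl fun j _ => ?_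
    rw [smul_mul_smul_comm, pow_add]
  have h2 : ∑ x ∈ Finset.range n ×ˢ Finset.range n, h ^ (x.1 + x.2) • (a x.1 * b x.2) =
      ∑ x ∈ (Finset.range n ×ˢ Finset.range n).filter (fun x => x.1 + x.2 < n),
        h ^ (x.1 + x.2) • (a x.1 * b x.2) := by
    refine (Finset.sum_subset (Finset.filter_subset _ _) fun x hx hx' => ?_).symm
    have : n ≤ x.1 + x.2 := by
      by_contra hlt
      exact hx' (Finset.mem_filter.2 ⟨hx, by omega⟩)
    rw [pow_eq_zero_of_le this hn, zero_smul]
  rw [h1, h2]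
  simp only [Finset.smul_sum]
  rw [Finset.sum_sigma']
  refine Finset.sum_nbij' (fun x => ⟨x.1 + x.2, x⟩) (fun y => y.2) ?_ ?_ ?_ ?_ ?_
  · intro x hx
    simp only [Finset.mem_filter] at hx
    simp only [Finset.mem_sigma, Finset.mem_range, Finset.HasAntidiagonal.mem_antidiagonal]
    exact ⟨hx.2, trivial⟩
  · rintro ⟨s, x⟩ hx
    simp only [Finset.mem_sigma, Finset.mem_range, Finset.HasAntidiagonal.mem_antidiagonal] at hx
    simp only [Finset.mem_filter, Finset.mem_product, Finset.mem_range]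
    omega
  · intro x _; rfl
  · rintro ⟨s, x⟩ hx
    simp only [Finset.mem_sigma, Finset.mem_range, Finset.HasAntidiagonal.mem_antidiagonal] at hx
    obtain ⟨_, rfl⟩ := hx
    rfl
  · intro x _; rfl

namespace MinimalAInfinity

variable {K} {A : Type*} [AddCommGroup A] [Module K A]
variable {𝒜 : ℤ → Submodule K A} [DirectSum.Decomposition 𝒜] (S : MinimalAInfinity 𝒜)

/-- The codifferential `Q' = q_1 + h q_2 + ⋯ + h^(n-1) q_n` of `A[h] / h^n`. -/
def deformQ (n : ℕ) : Module.End (Trunc K n) (Bar (Trunc K n) (Trunc K n ⊗[K] A)) :=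
  ∑ i ∈ Finset.range n, hvar K n ^ i • baseChangeEnd (Trunc K n) (S.q (i + 1))

theorem sum_q_succ_mul_q_succ (s : ℕ) :
    ∑ ij ∈ Finset.HasAntidiagonal.antidiagonal s, S.q (ij.1 + 1) * S.q (ij.2 + 1) = 0 := by
  have h := S.sum_q_mul_q (s + 2)
  rw [Finset.Nat.sum_antidiagonal_succ, Finset.Nat.sum_antidiagonal_succ'] at h
  simpa [S.q_zero] using h

/-- The `K[h] / h^n`-linear deformation `A[h] / h^n` of a minimal `A_∞`-algebra. -/
def deform (n : ℕ) : MinimalAInfinity (gradingBaseChange (Trunc K n) 𝒜) where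
  Q := S.deformQ n
  mem_Coder := Submodule.sum_mem _ fun i _ => Submodule.smul_mem _ _
    (baseChangeEnd_mem_Coder _ 𝒜 (S.q_mem_Coder (i + 1)))
  sq_zero := by
    rw [deformQ, cauchy_mul (hvar_pow_self K n)]
    refine Finset.sum_eq_zero fun s _ => ?_
    simp only [← baseChangeEnd_mul]
    rw [← baseChangeEnd_sum, S.sum_q_succ_mul_q_succ, baseChangeEnd_zero, smul_zero]
  mem_weightFil := Submodule.sum_mem _ fun i _ => Submodule.smul_mem _ _
    (weightFil_antitone (by omega) (baseChangeEnd_mem_weightFil _ (S.q_mem_weightFil (i + 1))))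

end MinimalAInfinity

variable {K} {A : Type*} [AddCommGroup A] [Module K A]

/-- The formal derivative `δ_h D` of a `K[h] / h^(n+1)`-linear endomorphism `D`: the
`K[h] / h^n`-linear endomorphism whose value on a word with letters in `A` is the formal derivative
with respect to `h` of the value of `D`. -/
def hDeriv (n : ℕ) (D : Module.End (Trunc K (n + 1)) (Bar (Trunc K (n + 1)) (Trunc K (n + 1) ⊗[K] A))) :
    Module.End (Trunc K n) (Bar (Trunc K n) (Trunc K n ⊗[K] A)) :=
  extend (Trunc K n) <|
    ((incl K (Trunc K n)).liftBaseChange (Trunc K n)).restrictScalars K ∘ₗ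
    (truncDeriv K n).rTensor (Bar K A) ∘ₗ
    (toBaseChange K (Trunc K (n + 1))).restrictScalars K ∘ₗ
    D.restrictScalars K ∘ₗ incl K (Trunc K (n + 1))

namespace MinimalAInfinity

variable {𝒜 : ℤ → Submodule K A} [DirectSum.Decomposition 𝒜] (S : MinimalAInfinity 𝒜)

/-- `δ_h Q' = q_2 + 2 h q_3 + ⋯ + n h^(n-1) q_{n+1}` for `Q' = q_1 + h q_2 + ⋯ + h^n q_{n+1}`. -/
theorem hDeriv_deformQ (n : ℕ) : hDeriv n (S.deformQ (n + 1)) =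
    ∑ i ∈ Finset.range n, hvar K n ^ i •
      baseChangeEnd (Trunc K n) (((i + 1 : ℕ) : K) • S.q (i + 2)) := by
  refine hom_ext_incl _ fun x => ?_
  rw [hDeriv, extend_incl]
  simp only [LinearMap.comp_apply, LinearMap.restrictScalars_apply, deformQ, LinearMap.sum_apply,
    LinearMap.smul_apply, baseChangeEnd_incl, map_sum, map_smul, toBaseChange_incl]
  rw [Finset.sum_range_succ']
  simp only [TensorProduct.smul_tmul', smul_eq_mul, mul_one, LinearMap.rTensor_tmul,
    truncDeriv_hvar_pow, LinearMap.liftBaseChange_tmul]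
  simp only [Nat.cast_zero, zero_mul, zero_smul, add_zero, Nat.add_sub_cancel]
  refine Finset.sum_congr rfl fun i _ => ?_
  rw [mul_comm, mul_smul]
  congr 1
  rw [← algebraMap_smul (Trunc K n) ((i + 1 : ℕ) : K), map_natCast]

/-- `δ_h Q'` is a Hochschild cocycle of `A[h] / h^n`. -/
theorem hDeriv_deformQ_mem (n : ℕ) :
    hDeriv n (S.deformQ (n + 1)) ∈ (S.deform n).hochCocycles 1 := by
  rw [hDeriv_deformQ]
  refine ⟨?_, ?_⟩
  · exact Submodule.sum_mem _ fun i _ => Submodule.smul_mem _ _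
      (baseChangeEnd_mem_Coder _ 𝒜 (Submodule.smul_mem _ _ (S.q_mem_Coder (i + 2))))
  · change (S.deform n).diff 1 _ = 0
    rw [diff_one_apply]
    change S.deformQ n * _ + _ * S.deformQ n = 0
    rw [deformQ, cauchy_mul (hvar_pow_self K n), cauchy_mul (hvar_pow_self K n),
      ← Finset.sum_add_distrib]
    refine Finset.sum_eq_zero fun s _ => ?_
    rw [← smul_add]
    simp only [← baseChangeEnd_mul, ← baseChangeEnd_sum]
    have key : ∑ ij ∈ Finset.HasAntidiagonal.antidiagonal s,
          S.q (ij.1 + 1) * (((ij.2 + 1 : ℕ) : K) • S.q (ij.2 + 2)) +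
        ∑ ij ∈ Finset.HasAntidiagonal.antidiagonal s,
          (((ij.1 + 1 : ℕ) : K) • S.q (ij.1 + 2)) * S.q (ij.2 + 1) = 0 := by
      have h1 := Finset.Nat.sum_antidiagonal_succ' (n := s)
        (f := fun ij => ((ij.2 : ℕ) : K) • (S.q (ij.1 + 1) * S.q (ij.2 + 1)))
      have h2 := Finset.Nat.sum_antidiagonal_succ (n := s)
        (f := fun ij => ((ij.1 : ℕ) : K) • (S.q (ij.1 + 1) * S.q (ij.2 + 1)))
      simp only [Nat.cast_zero, zero_smul, zero_add] at h1 h2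
      simp only [mul_smul_comm, smul_mul_assoc]
      rw [← h1, ← h2, ← Finset.sum_add_distrib]
      have h3 : ∀ ij ∈ Finset.HasAntidiagonal.antidiagonal (s + 1),
          ((ij.2 : ℕ) : K) • (S.q (ij.1 + 1) * S.q (ij.2 + 1)) +
            ((ij.1 : ℕ) : K) • (S.q (ij.1 + 1) * S.q (ij.2 + 1)) =
          ((s + 1 : ℕ) : K) • (S.q (ij.1 + 1) * S.q (ij.2 + 1)) := by
        intro ij hij
        rw [Finset.HasAntidiagonal.mem_antidiagonal] at hij
        rw [← add_smul, ← Nat.cast_add, ← hij, add_comm]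
      rw [Finset.sum_congr rfl h3, ← Finset.smul_sum, S.sum_q_succ_mul_q_succ, smul_zero]
    have hadd : ∀ D E : Module.End K (Bar K A), baseChangeEnd (Trunc K n) (D + E) =
        baseChangeEnd (Trunc K n) D + baseChangeEnd (Trunc K n) E := fun D E =>
      hom_ext_incl _ fun x => by
        simp only [baseChangeEnd_incl, LinearMap.add_apply, map_add]
    rw [← hadd, key, baseChangeEnd_zero, smul_zero]

/-- The Kaledin–Lunts class `[δ_h Q']` of `A[h] / h^(n+1)`, where
`Q' = q_1 + h q_2 + ⋯ + h^n q_{n+1}`: a class of degree `1` in the `K[h] / h^n`-linear Hochschild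
cohomology of `A[h] / h^n`. -/
def kaledinLuntsClass (n : ℕ) : (S.deform n).HochschildCohomology 1 :=
  Submodule.Quotient.mk ⟨hDeriv n (S.deform (n + 1)).Q, S.hDeriv_deformQ_mem n⟩

end MinimalAInfinity

end Deformation
end AInfinity

end

/-!
The Kaledin–Lunts class vanishes when `[Q', X'] = δ_h Q'` for some `K[h] / h^n`-linear coderivation
`X'` of degree `0`. Such an `X'` is a polynomial `∑_{j < n} h^j X_j` whose coefficients are `K`-linear
coderivations (`endCoeff_mem_Coder`), so comparing powers of `h` turns this equation into the system
`∑_{i + j = s} [q_{i+1}, X_j] = (s + 1) q_{s+2}` for `s < n`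
(`MinimalAInfinity.kaledinLuntsClass_eq_zero_iff`).

The truncated Kaledin class vanishes when `[Q, D]` agrees with `q_2 + 2 q_3 + ⋯ + n q_{n+1}` up to
weight `n + 1` for some `D` of degree `0` in `F¹ Coder`. Comparing weights, this is the same system for
`X_j = D_{j+1}`, the component of `D` of weight `j + 1`
(`MinimalAInfinity.truncatedKaledinClass_eq_zero_iff`). Recovering the vanishing of the class from the
system uses that the error term is itself a coderivation, which holds because the commutator of
coderivations is one (`commutator_mem_Coder`).

The two systems differ only in that `X_j` need not be homogeneous of weight `j + 1`. Since `q_{i+1}` is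
homogeneous of weight `i + 1`, taking the component of weight `s + 2` in the `s`-th equation replaces
every `X_j` by its component of weight `j + 1` and does not change the right-hand side
(`MinimalAInfinity.weightComp_shiftedCommutator`).
-/

namespace AInfinity

/-! ### Weight components of sums and composites -/

section Weights

variable {R A : Type*} [CommRing R] [AddCommGroup A] [Module R A]

theorem weightComp_add (w : ℕ) (D E : Module.End R (Bar R A)) :
    weightComp w (D + E) = weightComp w D + weightComp w E := by
  refine ext_proj fun l k => ?_
  simp only [mul_add, add_mul, proj_mul_weightComp_mul_proj]
  split_ifs <;> simp

theorem weightComp_smul (w : ℕ) (r : R) (D : Module.End R (Bar R A)) :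
    weightComp w (r • D) = r • weightComp w D := by
  refine ext_proj fun l k => ?_
  simp only [mul_smul_comm, smul_mul_assoc, proj_mul_weightComp_mul_proj]
  split_ifs <;> simp

/-- Taking the weight `w` component, as a linear map. -/
noncomputable def weightCompₗ (w : ℕ) : Module.End R (Bar R A) →ₗ[R] Module.End R (Bar R A) where
  toFun := weightComp w
  map_add' := weightComp_add w
  map_smul' := weightComp_smul w

theorem weightComp_sub (w : ℕ) (D E : Module.End R (Bar R A)) :
    weightComp w (D - E) = weightComp w D - weightComp w E :=
  map_sub (weightCompₗ w) D E

theorem weightComp_sum {ι : Type*} (w : ℕ) (s : Finset ι) (D : ι → Module.End R (Bar R A)) :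
    weightComp w (∑ i ∈ s, D i) = ∑ i ∈ s, weightComp w (D i) :=
  map_sum (weightCompₗ w) D s

theorem weightComp_weightComp (w i : ℕ) (D : Module.End R (Bar R A)) :
    weightComp w (weightComp i D) = if w = i then weightComp i D else 0 := by
  refine ext_proj fun l k => ?_
  rw [proj_mul_weightComp_mul_proj]
  split_ifs with h1 h2 h2
  · rfl
  · rw [proj_mul_weightComp_mul_proj, if_neg (by omega)]; simp
  · rw [proj_mul_weightComp_mul_proj, if_neg (by omega)]
  · simp

theorem weightComp_eq_zero {w p : ℕ} (h : w < p) {D : Module.End R (Bar R A)}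
    (hD : D ∈ weightFil R A p) : weightComp w D = 0 := by
  refine ext_proj fun l k => ?_
  rw [proj_mul_weightComp_mul_proj]
  split_ifs with hk
  · rw [hD k l (by omega)]; simp
  · simp

theorem mem_weightFil_of_weightComp {p : ℕ} {D : Module.End R (Bar R A)}
    (hD : D ∈ weightFil R A 0) (h : ∀ w < p, weightComp w D = 0) : D ∈ weightFil R A p := by
  intro k l hkl
  by_cases hk : k < l
  · exact hD k l (by omega)
  · have := congrArg (fun E => proj R A l * E * proj R A k) (h (k - l) (by omega))
    simp only [proj_mul_weightComp_mul_proj] at this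
    rw [if_pos (by omega)] at this
    simpa using this

/-- No assumption on the weights of `E` is needed, since the left factor is homogeneous. -/
theorem weightComp_weightComp_mul (i j : ℕ) (D E : Module.End R (Bar R A)) :
    weightComp (i + j) (weightComp i D * E) = weightComp i D * weightComp j E := by
  refine ext_proj fun l k => ?_
  rw [proj_mul_weightComp_mul_proj, ← mul_assoc, ← mul_assoc, proj_mul_weightComp,
    mul_assoc (proj R A l * D), mul_assoc (proj R A l * D) _ (weightComp j E), mul_assoc _ (_ * _),
    mul_assoc _ (_ * _), proj_mul_weightComp_mul_proj, add_assoc]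
  split_ifs <;> simp

theorem weightComp_mul_weightComp (i j : ℕ) (D E : Module.End R (Bar R A)) :
    weightComp (i + j) (E * weightComp j D) = weightComp i E * weightComp j D := by
  refine ext_proj fun l k => ?_
  rw [proj_mul_weightComp_mul_proj]
  have h : proj R A l * (weightComp i E * weightComp j D) * proj R A k =
      proj R A l * E * (proj R A (l + i) * weightComp j D * proj R A k) := by
    rw [← mul_assoc, proj_mul_weightComp]
    simp only [mul_assoc]
  rw [h, proj_mul_weightComp_mul_proj]
  split_ifs with h1 h2 h2
  · subst h1
    rw [mul_assoc, mul_assoc, weightComp_mul_proj, if_pos (by omega)]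
    simp only [mul_assoc]
    rw [show l + (i + j) - j = l + i by omega]
  · omega
  · omega
  · simp

end Weights

/-! ### Commutators of coderivations -/

section Homogeneous

variable {R A : Type*} [CommRing R] [AddCommGroup A] [Module R A]
variable (𝒜 : ℤ → Submodule R A) [DirectSum.Decomposition 𝒜]

/-- `Bar R A` is spanned by its homogeneous elements. -/
theorem hom_ext_degPart {M : Type*} [AddCommGroup M] [Module R M] {f g : Bar R A →ₗ[R] M}
    (h : ∀ p, ∀ x ∈ degPart 𝒜 p, f x = g x) : f = g := by
  classical
  refine hom_ext_word fun w a => ?_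
  have ha : a = fun k => ∑ e ∈ (DirectSum.decompose 𝒜 (a k)).support,
      (DirectSum.decompose 𝒜 (a k) e : A) :=
    funext fun k => (DirectSum.sum_support_decompose 𝒜 (a k)).symm
  have hw : (word a : Bar R A) =
      ∑ r ∈ Fintype.piFinset fun k => (DirectSum.decompose 𝒜 (a k)).support,
        word fun k => (DirectSum.decompose 𝒜 (a k) (r k) : A) := by
    conv_lhs => rw [ha]
    simp only [word]
    rw [MultilinearMap.map_sum_finset, map_sum]
  rw [hw, map_sum, map_sum]
  exact Finset.sum_congr rfl fun r _ =>
    h _ _ (Submodule.subset_span ⟨w, _, r, fun k => SetLike.coe_mem _, rfl, rfl⟩)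

theorem koszulSign_of_mem (d : ℤ) {p : ℤ} {x : Bar R A} (hx : x ∈ degPart 𝒜 p) :
    koszulSign 𝒜 d x = ((d * p).negOnePow : ℤ) • x := by
  refine (Submodule.span_le.2 ?_ : degPart 𝒜 p ≤
    LinearMap.eqLocus (koszulSign 𝒜 d)
      (((d * p).negOnePow : ℤ) • (LinearMap.id : Module.End R (Bar R A)))) hx
  rintro _ ⟨w, a, e, ha, rfl, rfl⟩
  change koszulSign 𝒜 d (word a) = ((d * ∑ k, (e k - 1)).negOnePow : ℤ) • word a
  have hs : ((d * ∑ k, (e k - 1)).negOnePow : ℤ) = ∏ k, ((d * (e k - 1)).negOnePow : ℤ) := by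
    rw [Finset.mul_sum]
    generalize (Finset.univ : Finset (Fin (w + 1))) = s
    classical
    induction s using Finset.induction_on with
    | empty => simp
    | insert k s hk ih =>
      rw [Finset.sum_insert hk, Finset.prod_insert hk, Int.negOnePow_add, Units.val_mul, ih]
  have hl : (fun k => letterSign 𝒜 d (a k)) =
      fun k => (((d * (e k - 1)).negOnePow : ℤ) : R) • a k := by
    funext k
    rw [letterSign_of_mem 𝒜 d (ha k), Int.cast_smul_eq_zsmul]
  rw [koszulSign_word, hl, hs]
  simp only [word]
  rw [MultilinearMap.map_smul_univ, map_smul, ← Int.cast_prod, Int.cast_smul_eq_zsmul]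

theorem koszulSign_zero : koszulSign 𝒜 0 = 1 :=
  hom_ext_degPart 𝒜 fun p x hx => by simp [koszulSign_of_mem 𝒜 0 hx]

theorem koszulSign_mul_comm (d : ℤ) {D : Module.End R (Bar R A)} (hD : D ∈ Coder 𝒜 0) :
    koszulSign 𝒜 d * D = D * koszulSign 𝒜 d :=
  hom_ext_degPart 𝒜 fun p x hx => by
    have hDx : D x ∈ degPart 𝒜 p := by simpa using hD.1 p x hx
    rw [Module.End.mul_apply, Module.End.mul_apply, koszulSign_of_mem 𝒜 d hx,
      koszulSign_of_mem 𝒜 d hDx, map_zsmul]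

/-- The commutator with a coderivation of degree `0` preserves coderivations. Of the four terms of
`Δ Q D` the two mixed ones cancel against those of `Δ D Q`, because the Koszul sign operator commutes
with maps of degree `0`. -/
theorem commutator_mem_Coder {d : ℤ} {Q D : Module.End R (Bar R A)} (hQ : Q ∈ Coder 𝒜 d)
    (hD : D ∈ Coder 𝒜 0) : Q * D - D * Q ∈ Coder 𝒜 d := by
  have hdeg : ∀ p, ∀ x ∈ degPart 𝒜 p, D x ∈ degPart 𝒜 p := fun p x hx => by
    simpa using hD.1 p x hx
  refine ⟨fun p x hx => sub_mem (hQ.1 p _ (hdeg p x hx)) (hdeg _ _ (hQ.1 p x hx)), ?_⟩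
  have hκ := koszulSign_mul_comm 𝒜 d hD
  have h1 : ∀ x, comul R A (Q x) = TensorProduct.map Q LinearMap.id (comul R A x) +
      TensorProduct.map (koszulSign 𝒜 d) Q (comul R A x) := fun x => LinearMap.congr_fun hQ.2 x
  have h2 : ∀ x, comul R A (D x) = TensorProduct.map D LinearMap.id (comul R A x) +
      TensorProduct.map LinearMap.id D (comul R A x) := fun x => by
    have := LinearMap.congr_fun hD.2 x
    rw [koszulSign_zero] at this
    exact this
  refine LinearMap.ext fun x => ?_
  simp only [LinearMap.comp_apply, LinearMap.sub_apply, LinearMap.add_apply, map_sub,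
    Module.End.mul_apply, h1, h2, map_add]
  generalize comul R A x = z
  induction z using TensorProduct.induction_on with
  | zero => simp
  | tmul x y =>
    have hκx : koszulSign 𝒜 d (D x) = D (koszulSign 𝒜 d x) := LinearMap.congr_fun hκ x
    simp only [TensorProduct.map_tmul, LinearMap.id_apply, LinearMap.sub_apply,
      Module.End.mul_apply, hκx, TensorProduct.sub_tmul, TensorProduct.tmul_sub]
    abel
  | add z z' hz hz' =>
    simp only [map_add] at hz hz' ⊢
    refine Eq.trans ?_ ((congrArg₂ HAdd.hAdd hz hz').trans ?_) <;> abel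

end Homogeneous

/-! ### Applying a linear form to the scalars of a base change -/

section Contraction

variable {K S A : Type*} [Field K] [CommRing S] [Algebra K S] [AddCommGroup A] [Module K A]

/-- The map `Bar S (S ⊗ A) ≅ S ⊗ Bar K A → Bar K A` that applies a linear form `φ` on `S` to the
scalars. For `S = K[h] / h^n` and the `j`-th coefficient `φ`, it extracts the coefficient
of `h^j`. -/
noncomputable def contract (φ : S →ₗ[K] K) : Bar S (S ⊗[K] A) →ₗ[K] Bar K A :=
  (TensorProduct.lid K (Bar K A)).toLinearMap ∘ₗ φ.rTensor (Bar K A) ∘ₗ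
    (toBaseChange K S).restrictScalars K

theorem contract_smul_incl (φ : S →ₗ[K] K) (s : S) (x : Bar K A) :
    contract φ (s • incl K S x) = φ s • x := by
  simp only [contract, LinearMap.comp_apply, LinearMap.restrictScalars_apply, map_smul,
    toBaseChange_incl, TensorProduct.smul_tmul', smul_eq_mul, mul_one, LinearMap.rTensor_tmul,
    LinearEquiv.coe_coe, TensorProduct.lid_tmul]

/-- The analogue of `contract` for the tensor square of the bar construction. -/
noncomputable def contract₂ (φ : S →ₗ[K] K) :
    Bar S (S ⊗[K] A) ⊗[S] Bar S (S ⊗[K] A) →ₗ[K] Bar K A ⊗[K] Bar K A :=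
  (TensorProduct.lid K (Bar K A ⊗[K] Bar K A)).toLinearMap ∘ₗ φ.rTensor (Bar K A ⊗[K] Bar K A) ∘ₗ
    ((TensorProduct.AlgebraTensorModule.distribBaseChange K S (Bar K A) (Bar K A)).symm.toLinearMap
      ∘ₗ TensorProduct.map (toBaseChange K S) (toBaseChange K S)).restrictScalars K

theorem contract₂_smul_incl₂ (φ : S →ₗ[K] K) (s : S) (z : Bar K A ⊗[K] Bar K A) :
    contract₂ φ (s • incl₂ K S A z) = φ s • z := by
  have h : (TensorProduct.AlgebraTensorModule.distribBaseChange K S (Bar K A) (Bar K A)).symm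
      (TensorProduct.map (toBaseChange K S) (toBaseChange K S) (incl₂ K S A z)) = 1 ⊗ₜ z := by
    rw [LinearEquiv.symm_apply_eq]
    induction z using TensorProduct.induction_on with
    | zero => simp
    | tmul x y => simp [incl₂_tmul, toBaseChange_incl]
    | add x y hx hy => simp only [map_add, hx, hy, TensorProduct.tmul_add]
  simp only [contract₂, LinearMap.comp_apply, LinearMap.restrictScalars_apply, map_smul,
    LinearEquiv.coe_coe, h, TensorProduct.smul_tmul', smul_eq_mul, mul_one,
    LinearMap.rTensor_tmul, TensorProduct.lid_tmul]

theorem liftBaseChange_toBaseChange (y : Bar S (S ⊗[K] A)) :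
    (incl K S).liftBaseChange S (toBaseChange K S y) = y := by
  have : (incl K S).liftBaseChange S ∘ₗ toBaseChange K S =
      (LinearMap.id : Module.End S (Bar S (S ⊗[K] A))) :=
    hom_ext_incl S fun x => by
      simp only [LinearMap.comp_apply, toBaseChange_incl, LinearMap.liftBaseChange_tmul, one_smul,
        LinearMap.id_apply]
  exact LinearMap.congr_fun this y

theorem contract_mem_degPart (𝒜 : ℤ → Submodule K A) [DirectSum.Decomposition 𝒜]
    (φ : S →ₗ[K] K) {p : ℤ} {y : Bar S (S ⊗[K] A)}
    (hy : y ∈ degPart (gradingBaseChange S 𝒜) p) : contract φ y ∈ degPart 𝒜 p := by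
  have h := apply_mem_of_incl S 𝒜 ((degPart 𝒜 p).baseChange S) (toBaseChange K S) p
    (fun x hx => by
      rw [toBaseChange_incl]; exact Submodule.tmul_mem_baseChange_of_mem 1 hx) hy
  obtain ⟨z, hz⟩ := Submodule.toBaseChange_surjective S (degPart 𝒜 p) ⟨_, h⟩
  have hz' : ((degPart 𝒜 p).toBaseChange S z : S ⊗[K] Bar K A) = toBaseChange K S y := by rw [hz]
  change TensorProduct.lid K (Bar K A) (φ.rTensor (Bar K A) (toBaseChange K S y)) ∈ _
  rw [← hz']
  clear hz hz'
  induction z using TensorProduct.induction_on with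
  | zero => simp
  | tmul s x =>
    rw [Submodule.coe_toBaseChange_tmul, LinearMap.rTensor_tmul, TensorProduct.lid_tmul]
    exact Submodule.smul_mem _ _ x.2
  | add z z' hz hz' =>
    rw [map_add, Submodule.coe_add, map_add, map_add]
    exact add_mem hz hz'

theorem baseChangeEnd_sub (D E : Module.End K (Bar K A)) :
    baseChangeEnd S (D - E) = baseChangeEnd S D - baseChangeEnd S E :=
  hom_ext_incl _ fun x => by simp only [baseChangeEnd_incl, LinearMap.sub_apply, map_sub]

end Contraction

/-! ### Coefficients of powers of `h` -/

section TensorMapSum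

variable {R M N : Type*} [CommRing R] [AddCommGroup M] [Module R M] [AddCommGroup N] [Module R N]

theorem map_sum_left {ι : Type*} (s : Finset ι) (f : ι → Module.End R M) (g : Module.End R N) :
    TensorProduct.map (∑ i ∈ s, f i) g = ∑ i ∈ s, TensorProduct.map (f i) g := by
  classical
  induction s using Finset.induction_on with
  | empty => simp
  | insert i s hi ih =>
    rw [Finset.sum_insert hi, Finset.sum_insert hi, TensorProduct.map_add_left, ih]

theorem map_sum_right {ι : Type*} (s : Finset ι) (f : Module.End R M) (g : ι → Module.End R N) :
    TensorProduct.map f (∑ i ∈ s, g i) = ∑ i ∈ s, TensorProduct.map f (g i) := by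
  classical
  induction s using Finset.induction_on with
  | empty => simp
  | insert i s hi ih =>
    rw [Finset.sum_insert hi, Finset.sum_insert hi, TensorProduct.map_add_right, ih]

end TensorMapSum

section Coefficients

variable {K A : Type*} [Field K] [AddCommGroup A] [Module K A]

variable (K) in
/-- The coefficient of `h^j` as a linear form on `K[h] / h^n`, set to `0` for `n ≤ j`. -/
noncomputable def truncCoeff (n j : ℕ) : Trunc K n →ₗ[K] K :=
  ((Ideal.span {(Polynomial.X : K[X]) ^ n}).restrictScalars K).liftQ
    (if j < n then Polynomial.lcoeff K j else 0) (by
    intro f hf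
    obtain ⟨g, rfl⟩ := Ideal.mem_span_singleton.1 (show f ∈ Ideal.span _ from hf)
    rw [LinearMap.mem_ker]
    split_ifs with h
    · rw [Polynomial.lcoeff_apply, Polynomial.coeff_X_pow_mul', if_neg (by omega)]
    · rfl)

theorem truncCoeff_mk {n j : ℕ} (hj : j < n) (f : K[X]) :
    truncCoeff K n j (truncMk K n f) = f.coeff j := by
  change (if j < n then Polynomial.lcoeff K j else 0) f = _
  rw [if_pos hj, Polynomial.lcoeff_apply]

theorem truncCoeff_hvar_pow {n i : ℕ} (hi : i < n) (j : ℕ) :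
    truncCoeff K n i (hvar K n ^ j) = if i = j then 1 else 0 := by
  rw [hvar, ← map_pow, truncCoeff_mk hi, Polynomial.coeff_X_pow]

theorem sum_truncCoeff_smul (n : ℕ) (t : Trunc K n) :
    ∑ j ∈ Finset.range n, truncCoeff K n j t • hvar K n ^ j = t := by
  obtain ⟨f, rfl⟩ : ∃ f, truncMk K n f = t := Ideal.Quotient.mk_surjective t
  have h : ∑ j ∈ Finset.range n, truncCoeff K n j (truncMk K n f) • hvar K n ^ j =
      truncMk K n (∑ j ∈ Finset.range n, f.coeff j • Polynomial.X ^ j) := by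
    rw [map_sum]
    refine Finset.sum_congr rfl fun j hj => ?_
    rw [truncCoeff_mk (Finset.mem_range.1 hj), map_smul, map_pow, hvar]
  rw [h, ← sub_eq_zero, ← map_sub, truncMk_eq_zero, Polynomial.X_pow_dvd_iff]
  intro d hd
  simp only [Polynomial.coeff_sub, Polynomial.finsetSum_coeff, Polynomial.coeff_smul,
    Polynomial.coeff_X_pow, smul_eq_mul, mul_ite, mul_one, mul_zero]
  rw [Finset.sum_ite_eq, if_pos (Finset.mem_range.2 hd), sub_self]

theorem sum_hvar_pow_smul_incl_contract (n : ℕ) (y : Bar (Trunc K n) (Trunc K n ⊗[K] A)) :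
    ∑ j ∈ Finset.range n, hvar K n ^ j • incl K (Trunc K n) (contract (truncCoeff K n j) y) = y := by
  conv_rhs => rw [← liftBaseChange_toBaseChange y]
  simp only [contract, LinearMap.comp_apply, LinearMap.restrictScalars_apply]
  generalize toBaseChange K (Trunc K n) y = z
  induction z using TensorProduct.induction_on with
  | zero => simp
  | tmul t x =>
    simp only [LinearMap.rTensor_tmul, LinearEquiv.coe_coe, TensorProduct.lid_tmul, map_smul,
      LinearMap.liftBaseChange_tmul]
    conv_rhs => rw [← sum_truncCoeff_smul n t, Finset.sum_smul]
    refine Finset.sum_congr rfl fun j _ => ?_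
    rw [smul_comm, smul_assoc]
  | add z z' hz hz' =>
    simp only [map_add, smul_add, Finset.sum_add_distrib, hz, hz']

theorem eq_of_sum_hvar_pow_smul_incl₂ {n : ℕ} {x y : ℕ → Bar K A ⊗[K] Bar K A}
    (h : ∑ j ∈ Finset.range n, hvar K n ^ j • incl₂ K (Trunc K n) A (x j) =
      ∑ j ∈ Finset.range n, hvar K n ^ j • incl₂ K (Trunc K n) A (y j)) {i : ℕ} (hi : i < n) :
    x i = y i := by
  have := congrArg (contract₂ (truncCoeff K n i)) h
  simpa [contract₂_smul_incl₂, truncCoeff_hvar_pow hi, hi] using this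

theorem eq_of_sum_hvar_pow_smul_baseChangeEnd {n : ℕ} {D E : ℕ → Module.End K (Bar K A)}
    (h : ∑ j ∈ Finset.range n, hvar K n ^ j • baseChangeEnd (Trunc K n) (D j) =
      ∑ j ∈ Finset.range n, hvar K n ^ j • baseChangeEnd (Trunc K n) (E j)) {i : ℕ} (hi : i < n) :
    D i = E i := by
  refine LinearMap.ext fun x => ?_
  have := congrArg (contract (truncCoeff K n i)) (LinearMap.congr_fun h (incl K (Trunc K n) x))
  simpa [LinearMap.sum_apply, LinearMap.smul_apply, baseChangeEnd_incl, contract_smul_incl,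
    truncCoeff_hvar_pow hi, hi] using this

/-- The coefficient of `h^j` of a `K[h] / h^n`-linear endomorphism. -/
noncomputable def endCoeff (n j : ℕ)
    (X : Module.End (Trunc K n) (Bar (Trunc K n) (Trunc K n ⊗[K] A))) :
    Module.End K (Bar K A) :=
  contract (truncCoeff K n j) ∘ₗ X.restrictScalars K ∘ₗ incl K (Trunc K n)

theorem sum_endCoeff {n : ℕ} (X : Module.End (Trunc K n) (Bar (Trunc K n) (Trunc K n ⊗[K] A))) :
    ∑ j ∈ Finset.range n, hvar K n ^ j • baseChangeEnd (Trunc K n) (endCoeff n j X) = X := by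
  refine hom_ext_incl _ fun x => ?_
  simp only [LinearMap.sum_apply, LinearMap.smul_apply, baseChangeEnd_incl]
  exact sum_hvar_pow_smul_incl_contract n (X (incl K (Trunc K n) x))

variable (𝒜 : ℤ → Submodule K A) [DirectSum.Decomposition 𝒜]

/-- A `K[h] / h^n`-linear coderivation is a polynomial in `h` whose coefficients are `K`-linear
coderivations. -/
theorem endCoeff_mem_Coder {n j : ℕ} (hj : j < n) {d : ℤ}
    {X : Module.End (Trunc K n) (Bar (Trunc K n) (Trunc K n ⊗[K] A))}
    (hX : X ∈ Coder (gradingBaseChange (Trunc K n) 𝒜) d) : endCoeff n j X ∈ Coder 𝒜 d := by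
  refine ⟨fun p x hx => contract_mem_degPart 𝒜 _ (hX.1 p _ (incl_mem_degPart _ 𝒜 hx)), ?_⟩
  refine LinearMap.ext fun x => ?_
  have hco := LinearMap.congr_fun hX.2 (incl K (Trunc K n) x)
  have hD (i : ℕ) := baseChangeEnd_incl (Trunc K n) (endCoeff n i X)
  rw [← sum_endCoeff X] at hco
  simp only [LinearMap.comp_apply, LinearMap.add_apply] at hco ⊢
  refine eq_of_sum_hvar_pow_smul_incl₂ (x := fun i => comul K A (endCoeff n i X x))
    (y := fun i => TensorProduct.map (endCoeff n i X) LinearMap.id (comul K A x) +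
      TensorProduct.map (koszulSign 𝒜 d) (endCoeff n i X) (comul K A x)) ?_ hj
  simp only [map_sum_left, map_sum_right, TensorProduct.map_smul_left, TensorProduct.map_smul_right,
    LinearMap.sum_apply, LinearMap.smul_apply, hD, map_sum, map_smul, comul_incl] at hco
  rw [hco, ← Finset.sum_add_distrib]
  refine Finset.sum_congr rfl fun i _ => ?_
  rw [map_add, smul_add, map_incl₂ _ (hD i) (E := LinearMap.id) (fun _ => rfl),
    map_incl₂ _ (koszulSign_incl _ 𝒜 d) (hD i)]

end Coefficients

namespace MinimalAInfinity

/-! ### Vanishing of the truncated Kaledin class -/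

section Commutators

variable {R A : Type*} [CommRing R] [AddCommGroup A] [Module R A]
variable {𝒜 : ℤ → Submodule R A} [DirectSum.Decomposition 𝒜] (S : MinimalAInfinity 𝒜)

theorem diff_zero_apply (D : Module.End R (Bar R A)) : S.diff 0 D = S.Q * D - D * S.Q := by
  simp [diff]

/-- The sum `∑_{i + j = s} [q_{i+1}, X_j]`. For `X' = ∑ h^j X_j` it is the coefficient of `h^s`
in `[Q', X']`. -/
noncomputable def shiftedCommutator (X : ℕ → Module.End R (Bar R A)) (s : ℕ) :
    Module.End R (Bar R A) :=
  ∑ ij ∈ Finset.HasAntidiagonal.antidiagonal s, S.q (ij.1 + 1) * X ij.2 -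
    ∑ ij ∈ Finset.HasAntidiagonal.antidiagonal s, X ij.1 * S.q (ij.2 + 1)

/-- Only the components `D_1, …, D_{s+1}` contribute, since `q_0 = 0` and `D_0 = 0`. -/
theorem weightComp_diff_zero {D : Module.End R (Bar R A)} (hD : D ∈ weightFil R A 1) (s : ℕ) :
    weightComp (s + 2) (S.diff 0 D) = S.shiftedCommutator (fun j => weightComp (j + 1) D) s := by
  have h0 : weightComp 0 D = 0 := weightComp_eq_zero Nat.zero_lt_one hD
  have hq0 : weightComp 0 S.Q = 0 := S.q_zero
  rw [diff_zero_apply, weightComp_sub,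
    ← sum_weightComp_mul (weightFil_antitone (Nat.zero_le 1) S.mem_weightFil)
      (weightFil_antitone (Nat.zero_le 1) hD),
    ← sum_weightComp_mul (weightFil_antitone (Nat.zero_le 1) hD)
      (weightFil_antitone (Nat.zero_le 1) S.mem_weightFil)]
  rw [Finset.Nat.sum_antidiagonal_succ, Finset.Nat.sum_antidiagonal_succ',
    Finset.Nat.sum_antidiagonal_succ, Finset.Nat.sum_antidiagonal_succ']
  simp [h0, hq0, shiftedCommutator, q]

/-- Passing from `X_j` to its component of weight `j + 1` picks out the component of weight `s + 2`
of the commutator sums, since `q_{i+1}` is homogeneous of weight `i + 1`. -/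
theorem weightComp_shiftedCommutator (X : ℕ → Module.End R (Bar R A)) (s : ℕ) :
    weightComp (s + 2) (S.shiftedCommutator X s) =
      S.shiftedCommutator (fun j => weightComp (j + 1) (X j)) s := by
  rw [shiftedCommutator, shiftedCommutator, weightComp_sub, weightComp_sum, weightComp_sum]
  congr 1
  all_goals
    refine Finset.sum_congr rfl fun ij hij => ?_
    rw [Finset.HasAntidiagonal.mem_antidiagonal] at hij
    rw [show s + 2 = (ij.1 + 1) + (ij.2 + 1) by omega]
  · exact weightComp_weightComp_mul _ _ _ _
  · exact weightComp_mul_weightComp _ _ _ _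

theorem shiftedCommutator_congr {X Y : ℕ → Module.End R (Bar R A)} {s : ℕ}
    (h : ∀ j ≤ s, X j = Y j) : S.shiftedCommutator X s = S.shiftedCommutator Y s := by
  unfold shiftedCommutator
  congr 1
  all_goals
    refine Finset.sum_congr rfl fun ij hij => ?_
    rw [Finset.HasAntidiagonal.mem_antidiagonal] at hij
    rw [h _ (by omega)]

theorem weightComp_truncatedKaledinCocycle {m w : ℕ} (hw : w ≤ m) :
    weightComp w (S.truncatedKaledinCocycle m) = ((w : R) - 1) • S.q w := by
  rw [truncatedKaledinCocycle, weightComp_sum]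
  simp only [weightComp_smul, q, weightComp_weightComp, smul_ite, smul_zero]
  rw [Finset.sum_ite_eq]
  split_ifs with h
  · rfl
  · rw [Finset.mem_Icc] at h
    obtain rfl | rfl : w = 0 ∨ w = 1 := by omega
    · rw [← q, S.q_zero, smul_zero]
    · simp

/-- The truncated Kaledin class vanishes iff some `D ∈ F¹ Coder` of degree `0` satisfies
`[Q, D]_{s+2} = (s + 1) q_{s+2}` in each of the weights `s + 2 = 2, …, n + 1`. -/
theorem truncatedKaledinClass_eq_zero_iff (n : ℕ) : S.truncatedKaledinClass (n + 1) = 0 ↔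
    ∃ D ∈ Coder 𝒜 0, D ∈ weightFil R A 1 ∧ ∀ s < n,
      S.shiftedCommutator (fun j => weightComp (j + 1) D) s = ((s + 1 : ℕ) : R) • S.q (s + 2) := by
  have hc : ∀ s : ℕ, (((s + 2 : ℕ) : R) - 1) = ((s + 1 : ℕ) : R) := fun s => by push_cast; ring
  rw [truncatedKaledinClass, Submodule.Quotient.mk_eq_zero, Submodule.submoduleOf,
    Submodule.mem_comap]
  simp only [Submodule.subtype_apply, truncCoboundaries, sub_self, Submodule.mem_sup,
    Submodule.mem_map, Submodule.mem_inf]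
  constructor
  · rintro ⟨_, ⟨D, ⟨hD, hD1⟩, rfl⟩, E, ⟨-, hE⟩, h⟩
    refine ⟨D, hD, hD1, fun s hs => ?_⟩
    rw [← S.weightComp_diff_zero hD1, ← hc,
      ← S.weightComp_truncatedKaledinCocycle (show s + 2 ≤ n + 1 by omega), ← h, weightComp_add,
      weightComp_eq_zero (by omega) hE, add_zero]
  · rintro ⟨D, hD, hD1, h⟩
    have hdiff : S.diff 0 D ∈ weightFil R A 2 := by
      rw [diff_zero_apply]
      exact sub_mem (mul_mem_weightFil S.mem_weightFil hD1) (mul_mem_weightFil hD1 S.mem_weightFil)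
    have hcod : S.diff 0 D ∈ Coder 𝒜 1 := by
      rw [diff_zero_apply]
      exact commutator_mem_Coder 𝒜 S.mem_Coder hD
    have hT := S.truncatedKaledinCocycle_mem (n + 1)
    refine ⟨_, ⟨D, ⟨hD, hD1⟩, rfl⟩, S.truncatedKaledinCocycle (n + 1) - S.diff 0 D,
      ⟨sub_mem hT.1.1 hcod, ?_⟩, add_sub_cancel _ _⟩
    refine mem_weightFil_of_weightComp (sub_mem (weightFil_antitone (Nat.zero_le 1) hT.1.2)
      (weightFil_antitone (Nat.zero_le 2) hdiff)) fun w hw => ?_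
    rw [weightComp_sub, S.weightComp_truncatedKaledinCocycle (by omega), sub_eq_zero]
    match w, hw with
    | 0, _ => rw [weightComp_eq_zero (by omega) hdiff, S.q_zero, smul_zero]
    | 1, _ => rw [weightComp_eq_zero (by omega) hdiff]; simp
    | s + 2, hw => rw [S.weightComp_diff_zero hD1, h s (by omega), hc]

end Commutators

/-! ### Vanishing of the Kaledin–Lunts class -/

section Deformation

variable {K A : Type*} [Field K] [AddCommGroup A] [Module K A]
variable {𝒜 : ℤ → Submodule K A} [DirectSum.Decomposition 𝒜] (S : MinimalAInfinity 𝒜)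

theorem deform_diff_zero_sum (n : ℕ) (X : ℕ → Module.End K (Bar K A)) :
    (S.deform n).diff 0
        (∑ j ∈ Finset.range n, hvar K n ^ j • baseChangeEnd (Trunc K n) (X j)) =
      ∑ s ∈ Finset.range n,
        hvar K n ^ s • baseChangeEnd (Trunc K n) (S.shiftedCommutator X s) := by
  rw [diff_zero_apply]
  change S.deformQ n * _ - _ * S.deformQ n = _
  rw [deformQ, cauchy_mul (hvar_pow_self K n), cauchy_mul (hvar_pow_self K n),
    ← Finset.sum_sub_distrib]
  refine Finset.sum_congr rfl fun s _ => ?_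
  rw [← smul_sub]
  simp only [← baseChangeEnd_mul, ← baseChangeEnd_sum]
  rw [← baseChangeEnd_sub, shiftedCommutator]

/-- Comparing coefficients of powers of `h`, the Kaledin–Lunts class vanishes iff there are
coderivations `X_0, …, X_{n-1}` of degree `0` with `∑_{i + j = s} [q_{i+1}, X_j] = (s + 1) q_{s+2}`
for all `s < n`. -/
theorem kaledinLuntsClass_eq_zero_iff (n : ℕ) : S.kaledinLuntsClass n = 0 ↔
    ∃ X : ℕ → Module.End K (Bar K A), (∀ j < n, X j ∈ Coder 𝒜 0) ∧ ∀ s < n,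
      S.shiftedCommutator X s = ((s + 1 : ℕ) : K) • S.q (s + 2) := by
  rw [kaledinLuntsClass, Submodule.Quotient.mk_eq_zero, Submodule.submoduleOf,
    Submodule.mem_comap]
  change hDeriv n (S.deformQ (n + 1)) ∈ (S.deform n).hochCoboundaries 1 ↔ _
  rw [hDeriv_deformQ]
  simp only [hochCoboundaries, sub_self, Submodule.mem_map]
  constructor
  · rintro ⟨X, hX, h⟩
    rw [← sum_endCoeff X, deform_diff_zero_sum] at h
    exact ⟨fun j => endCoeff n j X, fun j hj => endCoeff_mem_Coder 𝒜 hj hX,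
      fun s hs => eq_of_sum_hvar_pow_smul_baseChangeEnd h hs⟩
  · rintro ⟨X, hX, h⟩
    refine ⟨∑ j ∈ Finset.range n, hvar K n ^ j • baseChangeEnd (Trunc K n) (X j),
      Submodule.sum_mem _ fun j hj => Submodule.smul_mem _ _
        (baseChangeEnd_mem_Coder _ 𝒜 (hX j (Finset.mem_range.1 hj))), ?_⟩
    rw [deform_diff_zero_sum]
    exact Finset.sum_congr rfl fun s hs => by rw [h s (Finset.mem_range.1 hs)]

end Deformation

end MinimalAInfinity

end AInfinity

/-! ### Comparison of the two classes -/

theorem mainTheorem5 {K A : Type*} [Field K] [CharZero K] [AddCommGroup A] [Module K A]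
    (𝒜 : ℤ → Submodule K A) [DirectSum.Decomposition 𝒜]
    (S : AInfinity.MinimalAInfinity 𝒜) (n : ℕ) :
    S.kaledinLuntsClass n = 0 ↔ S.truncatedKaledinClass (n + 1) = 0 := by
  open AInfinity in
  rw [S.kaledinLuntsClass_eq_zero_iff, S.truncatedKaledinClass_eq_zero_iff]
  constructor
  · rintro ⟨X, hX, h⟩
    -- In `Q'` the coefficient of `h^i` has weight `i + 1`; the same part of each `X_j` is kept.
    refine ⟨∑ j ∈ Finset.range n, weightComp (j + 1) (X j),
      Submodule.sum_mem _ fun j hj => weightComp_mem_Coder 𝒜 _ (hX j (Finset.mem_range.1 hj)),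
      Submodule.sum_mem _ fun j _ =>
        weightFil_antitone (by omega) (weightComp_mem_weightFil (j + 1) (X j)), fun s hs => ?_⟩
    have hX' : ∀ j ≤ s, weightComp (j + 1) (∑ i ∈ Finset.range n, weightComp (i + 1) (X i)) =
        weightComp (j + 1) (X j) := by
      intro j hj
      simp only [weightComp_sum, weightComp_weightComp, Nat.add_right_cancel_iff]
      rw [Finset.sum_ite_eq, if_pos (Finset.mem_range.2 (by omega))]
    rw [S.shiftedCommutator_congr hX', ← S.weightComp_shiftedCommutator, h s hs, weightComp_smul,
      MinimalAInfinity.q, weightComp_weightComp, if_pos rfl]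
  · rintro ⟨D, hD, -, h⟩
    exact ⟨fun j => weightComp (j + 1) D, fun j _ => weightComp_mem_Coder 𝒜 _ hD, h⟩
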